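/- Let $\mathbb T=\mathbb R/\mathbb Z$ carry the normalized Haar measure, and put $e_n(t)=e^{2\pi i nt}$. For a complex Banach space $X$, an $X$-valued trigonometric polynomial is a finite sum $f=\sum_n a_n e_n$ with $a_n\in X$; write $\widehat f(n)$ for its Fourier coefficients, and $D_I f=\sum_{n\in I}\widehat f(n)e_n$ for $I\subseteq\mathbb Z$. An interval of $\mathbb Z$ may be bounded or unbounded. An operator $T\in\mathcal L(X)$ is *strongly Kreiss bounded with constant $K_s$* if every $\lambda\in\mathbb C$ with $|\lambda|>1$ is in its resolvent set and $\|(\lambda-T)^{-n}\|\le K_s(|\lambda|-1)^{-n}$ for all $n\ge 1$. **Theorem.** Let $X$ be a complex Banach space, and let $p,q_0,q_1\in(1,\infty)$. (a) Let $\gamma_0\in[0,1-1/q_0)$ and $\gamma_1\in[0,1/q_1)$. Suppose that there are constants $U,L>0$ such that for every finite family $\mathcal I$ of pairwise disjoint intervals of $\mathbb Z$ and every $X$-valued trigonometric polynomial $f$ such that $\widehat f$ is supported in $\bigcup_{I\in\mathcal I}I$, $$\|f\|_{L^p(\mathbb T;X)}\le U\,(\#\mathcal I)^{\gamma_0}\Big(\sum_{I\in\mathcal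 I}\|D_If\|_{L^p(\mathbb T;X)}^{q_0}\Big)^{1/q_0},\qquad \Big(\sum_{I\in\mathcal I}\|D_If\|_{L^p(\mathbb T;X)}^{q_1}\Big)^{1/q_1}\le L\,(\#\mathcal I)^{\gamma_1}\|f\|_{L^p(\mathbb T;X)}.$$ Then for every $K_s$ there are constants $C,\beta>0$ such that every $T\in\mathcal L(X)$ that is strongly Kreiss bounded with constant $K_s$ satisfies $$\|T^n\|\le C\,n^{\frac12\left(\frac1{q_0}-\frac1{q_1}+\gamma_0+\gamma_1\right)}(\log(n+2))^{\beta},\qquad n\ge1.$$ (b) Suppose that $X$ has upper $\ell^{q_0}(L^p)$-decompositions and lower $\ell^{q_1}(L^p)$-decompositions, i.e. that there are constants $U,L>0$ such that for every partition $\mathcal I$ of $\mathbb Z$ into intervals and every $X$-valued trigonometric polynomial $f$, $$\|f\|_{L^p(\mathbb T;X)}\le U\Big(\sum_{I\in\mathcal I}\|D_If\|_{L^p(\mathbb T;X)}^{q_0}\Big)^{1/q_0},\qquad \Big(\sum_{I\in\mathcal I}\|D_If\|_{L^p(\mathbb T;X)}^{q_1}\Big)^{1/q_1}\le L\,\|f\|_{L^p(\mathbb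 T;X)}.$$ Then the conclusion of (a) holds with $\gamma_0=\gamma_1=0$. -/

import Mathlib

open MeasureTheory

/-- `f : 𝕋 → X` is an `X`-valued trigonometric polynomial `∑ n ∈ s, e_n a_n`, where
`e_n(t) = exp (2 π i n t)` and `𝕋 = ℝ / ℤ`. -/
def IsTrigPoly {X : Type*} [NormedAddCommGroup X] [NormedSpace ℂ X] (f : UnitAddCircle → X) :
    Prop :=
  ∃ (s : Finset ℤ) (a : ℤ → X), ∀ t, f t = ∑ n ∈ s, fourier n t • a n

/-- The norm of `L^p(𝕋; X)`, for the normalised Haar measure of the torus and `1 ≤ p < ∞`. -/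
noncomputable def torusNorm {X : Type*} [NormedAddCommGroup X] (p : ℝ) (f : UnitAddCircle → X) :
    ℝ :=
  (eLpNorm f (ENNReal.ofReal p) AddCircle.haarAddCircle).toReal

/-- The Fourier multiplier `D_I f = ∑ n, e_n 1_I(n) f̂(n)`; it is used for trigonometric polynomials
`f`, where the sum has finitely many nonzero terms. -/
noncomputable def fourierCut {X : Type*} [NormedAddCommGroup X] [NormedSpace ℂ X] (I : Set ℤ)
    (f : UnitAddCircle → X) : UnitAddCircle → X :=
  fun t => ∑ᶠ n : ℤ, fourier n t • I.indicator (fourierCoeff f) n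

/-- A family of pairwise disjoint intervals of `ℤ` (bounded or unbounded). -/
def IsDisjointIntervalFamily (F : Set (Set ℤ)) : Prop :=
  (∀ I ∈ F, I.OrdConnected) ∧ F.PairwiseDisjoint id

/-- A partition of `ℤ` into (nonempty) intervals. -/
def IsIntervalPartition (F : Set (Set ℤ)) : Prop :=
  Setoid.IsPartition F ∧ ∀ I ∈ F, I.OrdConnected

/-- Upper `ℓ^q(L^p)`-decompositions. -/
def HasUpperDecompositions (X : Type*) [NormedAddCommGroup X] [NormedSpace ℂ X] (p q : ℝ) : Prop :=
  ∃ U : ℝ, 0 < U ∧ ∀ F : Set (Set ℤ), IsIntervalPartition F →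
    ∀ f : UnitAddCircle → X, IsTrigPoly f →
      torusNorm p f ≤ U * (∑' I : F, torusNorm p (fourierCut (I : Set ℤ) f) ^ q) ^ (1 / q)

/-- Lower `ℓ^q(L^p)`-decompositions. -/
def HasLowerDecompositions (X : Type*) [NormedAddCommGroup X] [NormedSpace ℂ X] (p q : ℝ) : Prop :=
  ∃ L : ℝ, 0 < L ∧ ∀ F : Set (Set ℤ), IsIntervalPartition F →
    ∀ f : UnitAddCircle → X, IsTrigPoly f →
      (∑' I : F, torusNorm p (fourierCut (I : Set ℤ) f) ^ q) ^ (1 / q) ≤ L * torusNorm p f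

/-- The upper `ℓ^q(L^p)`-estimate with growth `(#F)^γ`, over all finite families `F` of disjoint
intervals and all trigonometric polynomials with Fourier support in the union of `F`. -/
def HasUpperDecompositionsWithGrowth (X : Type*) [NormedAddCommGroup X] [NormedSpace ℂ X]
    (p q γ : ℝ) : Prop :=
  ∃ U : ℝ, 0 < U ∧ ∀ F : Finset (Set ℤ), IsDisjointIntervalFamily (F : Set (Set ℤ)) →
    ∀ f : UnitAddCircle → X, IsTrigPoly f → Function.support (fourierCoeff f) ⊆ ⋃ I ∈ F, I →
      torusNorm p f ≤
        U * (F.card : ℝ) ^ γ * (∑ I ∈ F, torusNorm p (fourierCut I f) ^ q) ^ (1 / q)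

/-- The lower `ℓ^q(L^p)`-estimate with growth `(#F)^γ`, over all finite families `F` of disjoint
intervals and all trigonometric polynomials with Fourier support in the union of `F`. -/
def HasLowerDecompositionsWithGrowth (X : Type*) [NormedAddCommGroup X] [NormedSpace ℂ X]
    (p q γ : ℝ) : Prop :=
  ∃ L : ℝ, 0 < L ∧ ∀ F : Finset (Set ℤ), IsDisjointIntervalFamily (F : Set (Set ℤ)) →
    ∀ f : UnitAddCircle → X, IsTrigPoly f → Function.support (fourierCoeff f) ⊆ ⋃ I ∈ F, I →
      (∑ I ∈ F, torusNorm p (fourierCut I f) ^ q) ^ (1 / q) ≤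
        L * (F.card : ℝ) ^ γ * torusNorm p f

/-- `T` is strongly Kreiss bounded with constant `K`: every `z` with `|z| > 1` is in the resolvent
set of `T`, and `‖(z - T)^{-n}‖ ≤ K / (|z| - 1)^n` for all `n ≥ 1`. -/
def IsStronglyKreissBounded {X : Type*} [NormedAddCommGroup X] [NormedSpace ℂ X]
    (T : X →L[ℂ] X) (K : ℝ) : Prop :=
  ∀ z : ℂ, 1 < ‖z‖ → z ∈ resolventSet ℂ T ∧
    ∀ n : ℕ, 1 ≤ n → ‖resolvent T z ^ n‖ ≤ K / (‖z‖ - 1) ^ n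

/-! For `‖u‖ = 1`, the `r`-th power of the resolvent at `2 / u` is, up to normalization, the mean of
the powers `u ^ k T ^ k` against a negative binomial law with mean `r` and variance `2 r`. The
strong Kreiss condition bounds these means uniformly in `r` and `u`. Read as operator-valued
functions on the torus, they act boundedly on `L^p(𝕋; X)` and move frequencies by about `r`, with
spread about `√r`.

Apply such a mean to the initial orbit piece `∑ j < 4s, e_j T^j x`, where `4 r ≤ s ^ 2`. On the
frequencies from `r + s` to `r + 3 s` the result is the orbit itself times a scalar weight which, by
Chebyshev, is at least `1 / 2` and has bounded variation. Summation by parts and the boundedness of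
interval projections remove the weight. So orbit pieces of length `≲ √r` near time `r` are
controlled by an initial piece of comparable length (`coeffNorm_orbit_window_le`). The same
argument, transposed, controls pairings with the orbit (`norm_sum_orbit_window_le`), with no passage
to the dual space.

Cutting an orbit of length about `μ ^ 2` into about `μ` blocks of length about `μ`, the upper
decomposition bounds it by `μ ^ θ₀` times the bound for length about `μ`, where `θ₀ = 1/q₀ + γ₀`.
For pairings, the lower decomposition and Hölder give `θ₁ = 1 - 1/q₁ + γ₁`. Iterating
(`square_root_recursion`) gives `l ^ θ` at length `l`, times a constant to the power `log log l`,
that is, a power of `log l`.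

Finally, `T ^ n` factors in about `√n` ways as a power of exponent `≲ √n` times one from an orbit
window just before `n`. Pairing the two pieces (`mul_norm_pow_le`) gives `√n ‖T ^ n‖ ≲ (√n) ^ (θ₀ +
θ₁)` up to logarithms. -/

/-! ### Powers of a geometric series and the negative binomial law -/

theorem sum_range_succ_multichoose (n k : ℕ) :
    ∑ i ∈ Finset.range (k + 1), n.multichoose i = (n + 1).multichoose k := by
  induction k with
  | zero => simp
  | succ k ih => rw [Finset.sum_range_succ, ih, Nat.multichoose_succ_succ, add_comm]

/-- Induction on `n` by Cauchy products with the geometric series. It is used twice: for a scalar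
`x` it normalizes the negative binomial law, and for an operator `x` it expands powers of the
resolvent. -/
theorem summable_norm_multichoose_mul_pow {A : Type*} [NormedRing A] [CompleteSpace A] {x : A}
    (hx : Summable fun k : ℕ => ‖x ^ k‖) (n : ℕ) :
    (Summable fun k : ℕ => ‖(n.multichoose k : A) * x ^ k‖) ∧
      ∑' k : ℕ, (n.multichoose k : A) * x ^ k = (∑' k : ℕ, x ^ k) ^ n := by
  induction n with
  | zero =>
    have h0 : ∀ k ∉ ({0} : Finset ℕ), ((0 : ℕ).multichoose k : A) * x ^ k = 0 := by
      intro k hk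
      obtain ⟨j, rfl⟩ := Nat.exists_eq_succ_of_ne_zero (by simpa using hk)
      simp
    refine ⟨summable_of_ne_finset_zero (s := {0}) fun k hk => by rw [h0 k hk, norm_zero], ?_⟩
    rw [tsum_eq_sum h0]
    simp
  | succ n ih =>
    have key : ∀ k : ℕ, ∑ kl ∈ Finset.HasAntidiagonal.antidiagonal k,
        ((n.multichoose kl.1 : A) * x ^ kl.1) * x ^ kl.2 =
          ((n + 1).multichoose k : A) * x ^ k := by
      intro k
      rw [← sum_range_succ_multichoose, Nat.cast_sum, Finset.sum_mul,
        Finset.Nat.sum_antidiagonal_eq_sum_range_succ_mk]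
      refine Finset.sum_congr rfl fun i hi => ?_
      rw [mul_assoc, ← pow_add, Nat.add_sub_cancel' (Finset.mem_range_succ_iff.1 hi)]
    have h1 := summable_norm_sum_mul_antidiagonal_of_summable_norm ih.1 hx
    have h2 := tsum_mul_tsum_eq_tsum_sum_antidiagonal_of_summable_norm ih.1 hx
    simp only [key] at h1 h2
    exact ⟨h1, by rw [← h2, ih.2, pow_succ]⟩

/-- The negative binomial distribution with parameters `r` and `1 / 2`, of mean `r` and variance
`2 r`. -/
noncomputable def negBinWeight (r k : ℕ) : ℝ := r.multichoose k / 2 ^ (r + k)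

theorem negBinWeight_nonneg (r k : ℕ) : 0 ≤ negBinWeight r k := by
  unfold negBinWeight; positivity

theorem hasSum_negBinWeight (r : ℕ) : HasSum (negBinWeight r) 1 := by
  have hx : Summable fun k : ℕ => ‖((1 / 2 : ℝ)) ^ k‖ := by
    simpa using summable_geometric_two
  obtain ⟨h1, h2⟩ := summable_norm_multichoose_mul_pow hx r
  have h3 := h1.of_norm.hasSum.mul_left ((1 / 2 : ℝ) ^ r)
  rw [h2, tsum_geometric_two, ← mul_pow] at h3
  have e : negBinWeight r = fun k => (1 / 2 : ℝ) ^ r * (r.multichoose k * (1 / 2 : ℝ) ^ k) := by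
    funext k
    rw [negBinWeight, pow_add, one_div_pow, one_div_pow]
    field_simp
  rwa [one_div_mul_cancel two_ne_zero, one_pow, ← e] at h3

theorem succ_mul_multichoose_succ (n k : ℕ) :
    (k + 1) * n.multichoose (k + 1) = n * (n + 1).multichoose k := by
  cases n with
  | zero => simp
  | succ n =>
    rw [Nat.multichoose_eq, Nat.multichoose_eq]
    have e1 : n + 1 + (k + 1) - 1 = n + k + 1 := by omega
    have e2 : n + 1 + 1 + k - 1 = n + k + 1 := by omega
    rw [e1, e2, mul_comm, Nat.choose_succ_right_eq, mul_comm]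
    congr 1
    omega

/-- This identity reduces each factorial moment to a lower one with `r` raised by one, hence
eventually to the total mass. -/
theorem succ_mul_negBinWeight_succ (r k : ℕ) :
    ((k : ℝ) + 1) * negBinWeight r (k + 1) = r * negBinWeight (r + 1) k := by
  have h := succ_mul_multichoose_succ r k
  have h' : ((k : ℝ) + 1) * r.multichoose (k + 1) = r * (r + 1).multichoose k := by
    exact_mod_cast h
  rw [negBinWeight, negBinWeight, ← mul_div_assoc, h', mul_div_assoc, add_right_comm r 1 k,
    ← add_assoc r k 1]

theorem hasSum_mul_negBinWeight (r : ℕ) :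
    HasSum (fun k : ℕ => (k : ℝ) * negBinWeight r k) r := by
  rw [← hasSum_nat_add_iff' 1]
  simpa [succ_mul_negBinWeight_succ] using (hasSum_negBinWeight (r + 1)).mul_left (r : ℝ)

theorem hasSum_mul_mul_negBinWeight (r : ℕ) :
    HasSum (fun k : ℕ => (k : ℝ) * (k - 1) * negBinWeight r k) (r * (r + 1)) := by
  rw [← hasSum_nat_add_iff' 1]
  have h := (hasSum_mul_negBinWeight (r + 1)).mul_left (r : ℝ)
  push_cast at h
  simp only [Finset.range_one, Finset.sum_singleton, Nat.cast_zero, zero_mul, sub_zero,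
    Nat.cast_add, Nat.cast_one, add_sub_cancel_right]
  refine h.congr_fun ?_ |> fun h => h
  intro k
  rw [mul_right_comm, succ_mul_negBinWeight_succ]
  ring

theorem hasSum_sq_mul_negBinWeight (r : ℕ) :
    HasSum (fun k : ℕ => ((k : ℝ) - r) ^ 2 * negBinWeight r k) (2 * r) := by
  have h := ((hasSum_mul_mul_negBinWeight r).add
    ((hasSum_mul_negBinWeight r).mul_left (1 - 2 * (r : ℝ)))).add
    ((hasSum_negBinWeight r).mul_left ((r : ℝ) ^ 2))
  convert h using 1
  · ext k; ring
  · ring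

/-- Chebyshev's inequality for the negative binomial distribution. -/
theorem half_le_sum_negBinWeight {r s M : ℕ} (hs : 0 < s) (hrs : 4 * r ≤ s ^ 2) (hM : r + s ≤ M) :
    1 / 2 ≤ ∑ k ∈ (Finset.range M).filter (fun k => r < k + s ∧ k < r + s), negBinWeight r k := by
  set F := (Finset.range M).filter (fun k => r < k + s ∧ k < r + s) with hF
  have h1 : HasSum (fun k => if k ∈ F then negBinWeight r k else 0)
      (∑ k ∈ F, negBinWeight r k) := by
    have h : HasSum (fun k => if k ∈ F then negBinWeight r k else 0)
        (∑ k ∈ F, if k ∈ F then negBinWeight r k else 0) :=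
      hasSum_sum_of_ne_finset_zero fun k hk => by simp [hk]
    rwa [Finset.sum_congr rfl fun k hk => if_pos hk] at h
  -- Compare the law termwise with its restriction to `F` plus `(k - r) ^ 2 / s ^ 2` times itself;
  -- the second part has mass `2 r / s ^ 2 ≤ 1 / 2`.
  have h2 := h1.add ((hasSum_sq_mul_negBinWeight r).div_const ((s : ℝ) ^ 2))
  have hs' : (0 : ℝ) < (s : ℝ) ^ 2 := by positivity
  have h3 := hasSum_le (fun k => ?_) (hasSum_negBinWeight r) h2
  · have h4 : 2 * (r : ℝ) / (s : ℝ) ^ 2 ≤ 1 / 2 := by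
      rw [div_le_iff₀ hs']
      have : 4 * (r : ℝ) ≤ (s : ℝ) ^ 2 := by exact_mod_cast hrs
      linarith
    linarith
  · have hb := negBinWeight_nonneg r k
    by_cases hk : k ∈ F
    · simp only [hk, if_true]
      have : 0 ≤ ((k : ℝ) - r) ^ 2 * negBinWeight r k / (s : ℝ) ^ 2 := by positivity
      linarith
    · simp only [hk, if_false, zero_add]
      rw [le_div_iff₀ hs', mul_comm]
      refine mul_le_mul_of_nonneg_right ?_ hb
      rw [sq_le_sq, abs_of_nonneg (by positivity : (0 : ℝ) ≤ s), le_abs]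
      simp only [hF, Finset.mem_filter, Finset.mem_range, not_and, not_lt] at hk
      by_cases hk1 : r < k + s
      · left
        have : r + s ≤ k := by
          by_cases hkM : k < M
          · exact hk hkM hk1
          · omega
        have : (r : ℝ) + s ≤ k := by exact_mod_cast this
        linarith
      · right
        have : (k : ℝ) + s ≤ r := by exact_mod_cast not_lt.1 hk1
        linarith

/-! ### Bounded means of powers from the strong Kreiss condition -/

/-- The spectral radius is at most `1`, so Gelfand's formula gives `‖T ^ k‖ ≤ (3 / 2) ^ k`
eventually. -/
theorem summable_norm_pow_half {A : Type*} [NormedRing A] [NormedAlgebra ℂ A] [CompleteSpace A]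
    {T : A} (hT : ∀ z : ℂ, 1 < ‖z‖ → z ∈ resolventSet ℂ T) :
    Summable fun k : ℕ => ‖T ^ k‖ / 2 ^ k := by
  have hr : spectralRadius ℂ T < ENNReal.ofReal (3 / 2) := by
    refine lt_of_le_of_lt (b := 1) (iSup₂_le fun z hz => ?_) ?_
    · have : ¬ 1 < ‖z‖ := fun h => hz (hT z h)
      have : ‖z‖₊ ≤ 1 := not_lt.1 this
      exact_mod_cast this
    · rw [ENNReal.one_lt_ofReal]; norm_num
  have hlim := spectrum.pow_norm_pow_one_div_tendsto_nhds_spectralRadius T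
  have hev := hlim.eventually_lt_const hr
  have hg : Summable fun k : ℕ => (3 / 4 : ℝ) ^ k :=
    summable_geometric_of_lt_one (by norm_num) (by norm_num)
  refine Summable.of_norm_bounded_eventually_nat hg ?_
  filter_upwards [hev, Filter.eventually_gt_atTop 0] with k hk hk0
  rw [ENNReal.ofReal_lt_ofReal_iff (by norm_num)] at hk
  have h1 : ‖T ^ k‖ ≤ (3 / 2 : ℝ) ^ k := by
    have h2 := pow_le_pow_left₀ (by positivity) hk.le k
    rwa [← Real.rpow_natCast, ← Real.rpow_mul (norm_nonneg _), one_div,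
      inv_mul_cancel₀ (by positivity), Real.rpow_one] at h2
  rw [Real.norm_of_nonneg (by positivity), div_le_iff₀ (by positivity), ← mul_pow]
  norm_num
  exact h1

theorem norm_sum_range_le_norm_tsum_add {E : Type*} [NormedAddCommGroup E] [CompleteSpace E]
    {f : ℕ → E} (hf : Summable fun k => ‖f k‖) (M : ℕ) :
    ‖∑ k ∈ Finset.range M, f k‖ ≤ ‖∑' k, f k‖ + ∑' k, ‖f (k + M)‖ := by
  rw [← hf.of_norm.sum_add_tsum_nat_add M]
  have hs : Summable fun k => ‖f (k + M)‖ := (summable_nat_add_iff (f := fun k => ‖f k‖) M).2 hf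
  have h := norm_tsum_le_tsum_norm hs
  have h' := norm_le_add_norm_add (∑ k ∈ Finset.range M, f k) (∑' k, f (k + M))
  linarith

/-- For `‖u‖ = 1` the negative binomial means of the powers of `u T` are powers of the resolvent at
`2 / u`; after truncation the bound survives up to an additive constant. -/
theorem exists_norm_sum_negBinWeight_le {X : Type*} [NormedAddCommGroup X] [NormedSpace ℂ X]
    [CompleteSpace X] {T : X →L[ℂ] X} {K : ℝ} (hT : IsStronglyKreissBounded T K) (r M₀ : ℕ) :
    ∃ M, M₀ ≤ M ∧ ∀ u : ℂ, ‖u‖ = 1 →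
      ‖∑ k ∈ Finset.range M, ((negBinWeight r k : ℂ) * u ^ k) • T ^ k‖ ≤ |K| + 2 := by
  have hsum : Summable fun k : ℕ => ‖T ^ k‖ / 2 ^ k :=
    summable_norm_pow_half fun z hz => (hT z hz).1
  have hx : ∀ u : ℂ, ‖u‖ = 1 → Summable fun k : ℕ => ‖((u / 2) • T) ^ k‖ := by
    intro u hu
    refine hsum.congr fun k => ?_
    rw [smul_pow, norm_smul, norm_pow (u / 2), norm_div, hu]
    simp [div_eq_inv_mul]
  have hterm : ∀ (u : ℂ) (k : ℕ), ((negBinWeight r k : ℂ) * u ^ k) • T ^ k =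
      ((1 / 2 : ℂ) ^ r) • ((r.multichoose k : X →L[ℂ] X) * ((u / 2) • T) ^ k) := by
    intro u k
    rw [← nsmul_eq_mul, smul_pow, ← Nat.cast_smul_eq_nsmul ℂ, smul_smul, smul_smul]
    congr 1
    unfold negBinWeight
    push_cast
    rw [pow_add, div_pow, div_pow, one_pow]
    field_simp
  have hnorm : ∀ u : ℂ, ‖u‖ = 1 → ∀ k, ‖((negBinWeight r k : ℂ) * u ^ k) • T ^ k‖ =
      negBinWeight r k * ‖T ^ k‖ := by
    intro u hu k
    rw [norm_smul, norm_mul, norm_pow, hu, one_pow, mul_one, Complex.norm_real,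
      Real.norm_of_nonneg (negBinWeight_nonneg r k)]
  have hsumu : ∀ u : ℂ, ‖u‖ = 1 →
      Summable fun k => ‖((negBinWeight r k : ℂ) * u ^ k) • T ^ k‖ := by
    intro u hu
    simp only [hterm, norm_smul]
    exact (summable_norm_multichoose_mul_pow (hx u hu) r).1.mul_left _
  have hsumb : Summable fun k => negBinWeight r k * ‖T ^ k‖ := by
    refine (hsumu 1 (by simp)).congr fun k => hnorm 1 (by simp) k
  have hfull : ∀ u : ℂ, ‖u‖ = 1 →
      ‖∑' k, ((negBinWeight r k : ℂ) * u ^ k) • T ^ k‖ ≤ |K| + 1 := by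
    intro u hu
    have hu0 : u ≠ 0 := by rintro rfl; simp at hu
    have hz : ‖2 / u‖ = 2 := by rw [norm_div, hu]; simp
    obtain ⟨hres, hK⟩ := hT (2 / u) (by rw [hz]; norm_num)
    -- The point `2 / u` has modulus `2`, so the Kreiss bound there is `K / 1 ^ r`, and the factors
    -- `2 ^ r` and `(1 / 2) ^ r` cancel.
    have hgeo : (∑' k : ℕ, ((u / 2) • T) ^ k) = (2 / u) • resolvent T (2 / u) := by
      set g := ∑' k : ℕ, ((u / 2) • T) ^ k
      have h1 : g * (1 - (u / 2) • T) = 1 := (hx u hu).of_norm.tsum_pow_mul_one_sub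
      have h2 : (1 - (u / 2) • T) = (u / 2) • (algebraMap ℂ (X →L[ℂ] X) (2 / u) - T) := by
        rw [smul_sub, Algebra.algebraMap_eq_smul_one, smul_smul]
        congr 1
        rw [div_mul_div_comm, mul_comm u 2, div_self (by simp [hu0]), one_smul]
      have h3 : (algebraMap ℂ (X →L[ℂ] X) (2 / u) - T) * resolvent T (2 / u) = 1 := by
        rw [resolvent]
        exact Ring.mul_inverse_cancel _ hres
      calc g = g * 1 := (mul_one g).symm
        _ = g * ((2 / u) • (1 - (u / 2) • T) * resolvent T (2 / u)) := by
          rw [h2, smul_smul, div_mul_div_comm, mul_comm u 2, div_self (by simp [hu0]), one_smul, h3]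
        _ = (2 / u) • (g * (1 - (u / 2) • T) * resolvent T (2 / u)) := by
          rw [smul_mul_assoc, mul_smul_comm, mul_assoc]
        _ = _ := by rw [h1, one_mul]
    simp only [hterm]
    rw [tsum_const_smul'', (summable_norm_multichoose_mul_pow (hx u hu) r).2, hgeo, smul_pow,
      smul_smul, norm_smul, norm_mul, norm_pow, norm_pow (2 / u), hz, ← mul_pow]
    norm_num
    -- At `r = 0` the mean is the identity, about which the Kreiss condition says nothing; this
    -- accounts for one unit in `|K| + 2`, and the truncated tail for the other. The case `r = 0` is
    -- needed for the second block of an orbit.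
    rcases Nat.eq_zero_or_pos r with rfl | hr
    · rw [pow_zero]
      refine (ContinuousLinearMap.norm_id_le).trans ?_
      linarith [abs_nonneg K]
    · have := hK r hr
      rw [hz] at this
      norm_num at this
      linarith [le_abs_self K]
  have htail := tendsto_order.1 (tendsto_sum_nat_add fun k => negBinWeight r k * ‖T ^ k‖)
  obtain ⟨M, hM1, hM2⟩ := ((htail.2 1 one_pos).and (Filter.eventually_ge_atTop M₀)).exists
  refine ⟨M, hM2, fun u hu => ?_⟩
  refine (norm_sum_range_le_norm_tsum_add (hsumu u hu) M).trans ?_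
  simp only [hnorm u hu]
  exact (add_le_add (hfull u hu) hM1.le).trans_eq (by ring)

/-! ### Trigonometric polynomials as finitely supported coefficient families -/

section TrigPoly

variable {X : Type*} [NormedAddCommGroup X]

/-- Restriction of the coefficients to the frequencies in `I`. -/
noncomputable def freqCut (I : Set ℤ) (a : ℤ →₀ X) : ℤ →₀ X :=
  open Classical in a.filter (· ∈ I)

theorem freqCut_apply (I : Set ℤ) (a : ℤ →₀ X) (n : ℤ) : freqCut I a n = I.indicator a n := by
  classical
  simp only [freqCut, Finsupp.filter_apply, Set.indicator_apply]

theorem freqCut_apply_of_mem {I : Set ℤ} {n : ℤ} (h : n ∈ I) (a : ℤ →₀ X) :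
    freqCut I a n = a n := by
  rw [freqCut_apply, Set.indicator_of_mem h]

theorem freqCut_apply_of_notMem {I : Set ℤ} {n : ℤ} (h : n ∉ I) (a : ℤ →₀ X) :
    freqCut I a n = 0 := by
  rw [freqCut_apply, Set.indicator_of_notMem h]

theorem freqCut_freqCut (I J : Set ℤ) (a : ℤ →₀ X) :
    freqCut I (freqCut J a) = freqCut (I ∩ J) a := by
  ext n
  by_cases hI : n ∈ I <;> by_cases hJ : n ∈ J <;> simp [freqCut_apply, hI, hJ]

/-- The reflection `n ↦ c - n` of the frequencies. -/
noncomputable def freqReflect (c : ℤ) (a : ℤ →₀ X) : ℤ →₀ X :=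
  a.equivMapDomain (Equiv.subLeft c)

theorem freqReflect_apply (c : ℤ) (a : ℤ →₀ X) (n : ℤ) : freqReflect c a n = a (c - n) := by
  simp [freqReflect, Finsupp.equivMapDomain_apply, Equiv.subLeft, sub_eq_add_neg, add_comm]

variable [NormedSpace ℂ X]

/-- The trigonometric polynomial with coefficients `a`. -/
noncomputable def trigPoly : (ℤ →₀ X) →ₗ[ℂ] (UnitAddCircle → X) :=
  Finsupp.lsum ℂ fun n => LinearMap.pi fun t => (fourier n t : ℂ) • LinearMap.id

@[simp]
theorem trigPoly_single (n : ℤ) (x : X) (t : UnitAddCircle) :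
    trigPoly (Finsupp.single n x) t = (fourier n t : ℂ) • x := by
  simp [trigPoly, -fourier_apply]

theorem trigPoly_apply (a : ℤ →₀ X) (t : UnitAddCircle) :
    trigPoly a t = ∑ n ∈ a.support, (fourier n t : ℂ) • a n := by
  simp [trigPoly, -fourier_apply, Finsupp.sum, Finset.sum_apply]

theorem isTrigPoly_trigPoly (a : ℤ →₀ X) : IsTrigPoly (trigPoly a) :=
  ⟨a.support, a, trigPoly_apply a⟩

theorem continuous_trigPoly (a : ℤ →₀ X) : Continuous (trigPoly a) := by
  rw [show trigPoly a = fun t => ∑ n ∈ a.support, (fourier n t : ℂ) • a n from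
    funext (trigPoly_apply a)]
  exact continuous_finsetSum _ fun n _ => (map_continuous (fourier n)).smul continuous_const

theorem aestronglyMeasurable_trigPoly (a : ℤ →₀ X) :
    AEStronglyMeasurable (trigPoly a) AddCircle.haarAddCircle :=
  (continuous_trigPoly a).aestronglyMeasurable

theorem memLp_trigPoly (a : ℤ →₀ X) (q : ENNReal) :
    MemLp (trigPoly a) q AddCircle.haarAddCircle := by
  obtain ⟨C, hC⟩ := isCompact_univ.exists_bound_of_continuousOn (continuous_trigPoly a).continuousOn
  exact MemLp.of_bound (aestronglyMeasurable_trigPoly a) C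
    (Filter.Eventually.of_forall fun t => hC t trivial)

theorem integrable_trigPoly (a : ℤ →₀ X) : Integrable (trigPoly a) AddCircle.haarAddCircle :=
  memLp_one_iff_integrable.1 (memLp_trigPoly a 1)

theorem integral_fourier_eq_zero {n : ℤ} (hn : n ≠ 0) :
    ∫ t : UnitAddCircle, (fourier n t : ℂ) ∂AddCircle.haarAddCircle = 0 :=
  integral_eq_zero_of_add_right_eq_neg (fourier_add_half_inv_index hn one_pos)

theorem fourierCoeff_trigPoly [CompleteSpace X] (a : ℤ →₀ X) (n : ℤ) :
    fourierCoeff (trigPoly a) n = a n := by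
  induction a using Finsupp.induction_linear with
  | zero => simp [fourierCoeff]
  | add a b ha hb =>
    rw [map_add, fourierCoeff.add (integrable_trigPoly a) (integrable_trigPoly b), Pi.add_apply,
      ha, hb, Finsupp.add_apply]
  | single m x =>
    have h : ∀ t : UnitAddCircle, (fourier (-n) t : ℂ) • trigPoly (Finsupp.single m x) t =
        (fourier (m - n) t : ℂ) • x := fun t => by
      rw [trigPoly_single, smul_smul, ← fourier_add, neg_add_eq_sub]
    simp only [fourierCoeff, h]
    rw [integral_smul_const]
    rcases eq_or_ne m n with rfl | hmn
    · simp
    · rw [integral_fourier_eq_zero (sub_ne_zero.2 hmn), zero_smul, Finsupp.single_eq_of_ne hmn.symm]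

theorem fourierCut_trigPoly [CompleteSpace X] (I : Set ℤ) (a : ℤ →₀ X) :
    fourierCut I (trigPoly a) = trigPoly (freqCut I a) := by
  funext t
  have h : ∀ n : ℤ, (fourier n t : ℂ) • I.indicator (fourierCoeff (trigPoly a)) n =
      (fourier n t : ℂ) • freqCut I a n := fun n => by
    rw [freqCut_apply, show fourierCoeff (trigPoly a) = a from funext (fourierCoeff_trigPoly a)]
  rw [fourierCut, finsum_congr h, trigPoly_apply]
  refine finsum_eq_sum_of_support_subset _ fun n hn => ?_
  rw [Finset.mem_coe, Finsupp.mem_support_iff]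
  intro h0
  exact hn (by simp [h0])

/-- The frequency shift by `d` of the coefficients, followed by the operator `A`. -/
noncomputable def freqShift (A : X →L[ℂ] X) (d : ℤ) (a : ℤ →₀ X) : ℤ →₀ X :=
  (a.mapRange A (map_zero A)).equivMapDomain (Equiv.addRight d)

theorem freqShift_apply (A : X →L[ℂ] X) (d : ℤ) (a : ℤ →₀ X) (n : ℤ) :
    freqShift A d a n = A (a (n - d)) := by
  simp [freqShift, Finsupp.equivMapDomain_apply, sub_eq_add_neg]

theorem trigPoly_freqShift (A : X →L[ℂ] X) (d : ℤ) (a : ℤ →₀ X) (t : UnitAddCircle) :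
    trigPoly (freqShift A d a) t = (fourier d t : ℂ) • A (trigPoly a t) := by
  induction a using Finsupp.induction_linear with
  | zero =>
    have : freqShift A d (0 : ℤ →₀ X) = 0 := by ext n; simp [freqShift_apply]
    simp [this]
  | add a b ha hb =>
    have : freqShift A d (a + b) = freqShift A d a + freqShift A d b := by
      ext n; simp [freqShift_apply]
    rw [this, map_add, map_add, Pi.add_apply, Pi.add_apply, ha, hb, map_add, smul_add]
  | single m x =>
    have : freqShift A d (Finsupp.single m x) = Finsupp.single (m + d) (A x) := by
      ext n
      rw [freqShift_apply, Finsupp.single_apply, Finsupp.single_apply]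
      by_cases h : m = n - d
      · rw [if_pos h, if_pos (by omega)]
      · rw [if_neg h, if_neg (by omega), map_zero]
    rw [this, trigPoly_single, trigPoly_single, map_smul, smul_smul, ← fourier_add, add_comm d m]

/-- The `L^p` norm of the trigonometric polynomial with coefficients `a`. -/
noncomputable def coeffNorm (p : ℝ) (a : ℤ →₀ X) : ℝ := torusNorm p (trigPoly a)

variable {p : ℝ}

theorem coeffNorm_nonneg (a : ℤ →₀ X) : 0 ≤ coeffNorm p a := ENNReal.toReal_nonneg

theorem coeffNorm_zero : coeffNorm p (0 : ℤ →₀ X) = 0 := by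
  simp [coeffNorm, torusNorm]

theorem coeffNorm_le_mul {a b : ℤ →₀ X} {B : ℝ} (hB : 0 ≤ B)
    (h : ∀ t, ‖trigPoly a t‖ ≤ B * ‖trigPoly b t‖) : coeffNorm p a ≤ B * coeffNorm p b := by
  have h1 := eLpNorm_le_mul_eLpNorm_of_ae_le_mul (μ := AddCircle.haarAddCircle)
    (Filter.Eventually.of_forall h) (ENNReal.ofReal p)
  have h2 := ENNReal.toReal_mono
    (ENNReal.mul_ne_top ENNReal.ofReal_ne_top (memLp_trigPoly b _).eLpNorm_ne_top) h1
  rwa [ENNReal.toReal_mul, ENNReal.toReal_ofReal hB] at h2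

theorem coeffNorm_smul_le (c : ℂ) (a : ℤ →₀ X) :
    coeffNorm p (c • a) ≤ ‖c‖ * coeffNorm p a :=
  coeffNorm_le_mul (norm_nonneg c) fun t => by rw [map_smul, Pi.smul_apply, norm_smul]

theorem coeffNorm_add_le (hp : 1 ≤ p) (a b : ℤ →₀ X) :
    coeffNorm p (a + b) ≤ coeffNorm p a + coeffNorm p b := by
  unfold coeffNorm torusNorm
  rw [← ENNReal.toReal_add (memLp_trigPoly a _).eLpNorm_ne_top
    (memLp_trigPoly b _).eLpNorm_ne_top, map_add]
  refine ENNReal.toReal_mono (ENNReal.add_ne_top.2 ⟨(memLp_trigPoly a _).eLpNorm_ne_top,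
    (memLp_trigPoly b _).eLpNorm_ne_top⟩) ?_
  exact eLpNorm_add_le (aestronglyMeasurable_trigPoly a) (aestronglyMeasurable_trigPoly b)
    (by rwa [ENNReal.one_le_ofReal])

theorem coeffNorm_sum_le (hp : 1 ≤ p) {ι : Type*} (s : Finset ι) (a : ι → ℤ →₀ X) :
    coeffNorm p (∑ i ∈ s, a i) ≤ ∑ i ∈ s, coeffNorm p (a i) := by
  classical
  induction s using Finset.induction_on with
  | empty => simp [coeffNorm_zero]
  | insert i s hi ih =>
    rw [Finset.sum_insert hi, Finset.sum_insert hi]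
    exact (coeffNorm_add_le hp _ _).trans (add_le_add_right ih _)

theorem coeffNorm_sub_le (hp : 1 ≤ p) (a b : ℤ →₀ X) :
    coeffNorm p (a - b) ≤ coeffNorm p a + coeffNorm p b := by
  rw [sub_eq_add_neg, ← neg_one_smul ℂ b]
  refine (coeffNorm_add_le hp _ _).trans (add_le_add_right ?_ _)
  simpa using coeffNorm_smul_le (p := p) (-1) b

theorem coeffNorm_single (hp : 1 ≤ p) (n : ℤ) (x : X) :
    coeffNorm p (Finsupp.single n x) = ‖x‖ := by
  have h1 : eLpNorm (trigPoly (Finsupp.single n x)) (ENNReal.ofReal p) AddCircle.haarAddCircle =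
      eLpNorm (fun _ : UnitAddCircle => x) (ENNReal.ofReal p) AddCircle.haarAddCircle :=
    eLpNorm_congr_norm_ae (Filter.Eventually.of_forall fun t => by
      rw [trigPoly_single, norm_smul, fourier_apply, Circle.norm_coe, one_mul])
  rw [coeffNorm, torusNorm, h1, eLpNorm_const' x
    (by rw [Ne, ENNReal.ofReal_eq_zero]; linarith) ENNReal.ofReal_ne_top]
  simp

theorem trigPoly_freqReflect (c : ℤ) (a : ℤ →₀ X) (t : UnitAddCircle) :
    trigPoly (freqReflect c a) t = (fourier c t : ℂ) • trigPoly a (-t) := by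
  induction a using Finsupp.induction_linear with
  | zero =>
    have : freqReflect c (0 : ℤ →₀ X) = 0 := by ext n; simp [freqReflect_apply]
    simp [this]
  | add a b ha hb =>
    have : freqReflect c (a + b) = freqReflect c a + freqReflect c b := by
      ext n; simp [freqReflect_apply]
    rw [this, map_add, map_add, Pi.add_apply, Pi.add_apply, ha, hb, smul_add]
  | single m x =>
    have : freqReflect c (Finsupp.single m x) = Finsupp.single (c - m) x := by
      ext n
      rw [freqReflect_apply, Finsupp.single_apply, Finsupp.single_apply]
      by_cases h : m = c - n
      · rw [if_pos h, if_pos (by omega)]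
      · rw [if_neg h, if_neg (by omega)]
    rw [this, trigPoly_single, trigPoly_single, smul_smul]
    congr 1
    rw [sub_eq_add_neg, fourier_add]
    congr 1
    simp [fourier_apply]

/-- On the torus the reflection is `t ↦ -t`, which preserves Haar measure, followed by a unimodular
factor. -/
theorem coeffNorm_freqReflect (c : ℤ) (a : ℤ →₀ X) :
    coeffNorm p (freqReflect c a) = coeffNorm p a := by
  have h1 : eLpNorm (trigPoly (freqReflect c a)) (ENNReal.ofReal p) AddCircle.haarAddCircle =
      eLpNorm (trigPoly a ∘ Neg.neg) (ENNReal.ofReal p) AddCircle.haarAddCircle :=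
    eLpNorm_congr_norm_ae (Filter.Eventually.of_forall fun t => by
      rw [trigPoly_freqReflect, norm_smul, fourier_apply, Circle.norm_coe, one_mul]; rfl)
  rw [coeffNorm, torusNorm, h1, eLpNorm_comp_measurePreserving (aestronglyMeasurable_trigPoly a)
    (Measure.measurePreserving_neg _)]
  rfl

/-- On the torus this is pointwise multiplication by an operator-valued function, so a uniform
operator bound suffices and no vector-valued multiplier theorem is needed. -/
theorem coeffNorm_sum_freqShift_le {ι : Type*} (s : Finset ι) (A : ι → X →L[ℂ] X) (d : ι → ℤ)
    {B : ℝ} (hB : ∀ t : UnitAddCircle, ‖∑ i ∈ s, (fourier (d i) t : ℂ) • A i‖ ≤ B) (a : ℤ →₀ X) :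
    coeffNorm p (∑ i ∈ s, freqShift (A i) (d i) a) ≤ B * coeffNorm p a := by
  refine coeffNorm_le_mul ((norm_nonneg _).trans (hB 0)) fun t => ?_
  have : trigPoly (∑ i ∈ s, freqShift (A i) (d i) a) t =
      (∑ i ∈ s, (fourier (d i) t : ℂ) • A i) (trigPoly a t) := by
    rw [map_sum, Finset.sum_apply, _root_.sum_apply]
    exact Finset.sum_congr rfl fun i _ => trigPoly_freqShift _ _ _ _
  rw [this]
  exact ContinuousLinearMap.le_of_opNorm_le _ (hB t) _

end TrigPoly

/-! ### Scalar multipliers of bounded variation -/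

section Multiplier

variable {X : Type*} [NormedAddCommGroup X] [NormedSpace ℂ X] {p E : ℝ}

variable (X) in
/-- The Fourier projections onto bounded intervals have norm at most `E` on `L^p(𝕋; X)`. -/
def IntervalProjectionBound (p E : ℝ) : Prop :=
  ∀ (u v : ℤ) (a : ℤ →₀ X), coeffNorm p (freqCut (Set.Ico u v) a) ≤ E * coeffNorm p a

theorem sum_single_apply {ι M : Type*} [AddCommMonoid M] (s : Finset ι) (d : ι → ℤ) (x : ι → M)
    (n : ℤ) : (∑ i ∈ s, Finsupp.single (d i) (x i)) n = ∑ i ∈ s, if d i = n then x i else 0 := by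
  rw [Finsupp.finsetSum_apply]
  exact Finset.sum_congr rfl fun i _ => Finsupp.single_apply

theorem sum_range_single_add_apply {M : Type*} [AddCommMonoid M] (u : ℤ) {l i : ℕ} (hi : i < l)
    (x : ℕ → M) : (∑ i ∈ Finset.range l, Finsupp.single (u + i) (x i)) (u + i) = x i := by
  rw [sum_single_apply, Finset.sum_eq_single i]
  · simp
  · intro j _ hj
    rw [if_neg (by omega)]
  · intro h
    exact absurd (Finset.mem_range.2 hi) h

theorem sum_range_single_add_apply_of_notMem {M : Type*} [AddCommMonoid M] {u n : ℤ} {l : ℕ}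
    (hn : n ∉ Set.Ico u (u + l)) (x : ℕ → M) :
    (∑ i ∈ Finset.range l, Finsupp.single (u + i) (x i)) n = 0 := by
  rw [sum_single_apply]
  refine Finset.sum_eq_zero fun i hi => if_neg ?_
  rintro rfl
  have := Finset.mem_range.1 hi
  exact hn ⟨by omega, by omega⟩

theorem freqCut_Ico_eq_sum {M : Type*} [NormedAddCommGroup M] (u : ℤ) (l : ℕ) (a : ℤ →₀ M) :
    freqCut (Set.Ico u (u + l)) a =
      ∑ i ∈ Finset.range l, Finsupp.single (u + i) (a (u + i)) := by
  ext n
  by_cases hn : n ∈ Set.Ico u (u + l)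
  · obtain ⟨h1, h2⟩ := hn
    obtain ⟨i, rfl⟩ := Int.le.dest h1
    rw [sum_range_single_add_apply u (by omega) fun i => a (u + i),
      freqCut_apply_of_mem (Set.mem_Ico.2 ⟨h1, h2⟩)]
  · rw [sum_range_single_add_apply_of_notMem hn, freqCut_apply_of_notMem hn]

/-- A scalar multiplier of bounded variation on an interval is bounded. -/
theorem coeffNorm_sum_single_smul_le (hp : 1 ≤ p) (hE : IntervalProjectionBound X p E)
    (u : ℤ) (l : ℕ) (m : ℕ → ℝ) {A V : ℝ} (hA : |m (l - 1)| ≤ A)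
    (hV : ∑ i ∈ Finset.range (l - 1), |m (i + 1) - m i| ≤ V) (a : ℤ →₀ X) :
    coeffNorm p (∑ i ∈ Finset.range l, Finsupp.single (u + i) ((m i : ℂ) • a (u + i))) ≤
      (A + V) * (E * coeffNorm p a) := by
  have hN : 0 ≤ E * coeffNorm p a := (coeffNorm_nonneg _).trans (hE 0 0 a)
  -- Abel summation leaves the last value of `m` and its increments, each multiplying an interval
  -- projection of `a`.
  have h := Finset.sum_range_by_parts (fun i => (m i : ℂ))
    (fun i => Finsupp.single (u + i) (a (u + i))) l
  simp only [Finsupp.smul_single] at h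
  rw [h, add_mul]
  simp only [← freqCut_Ico_eq_sum]
  refine (coeffNorm_sub_le hp _ _).trans (add_le_add ?_ ?_)
  · refine (coeffNorm_smul_le _ _).trans ?_
    rw [Complex.norm_real]
    exact mul_le_mul hA (hE _ _ _) (coeffNorm_nonneg _) ((abs_nonneg _).trans hA)
  · refine (coeffNorm_sum_le hp _ _).trans ?_
    refine le_trans ?_ (mul_le_mul_of_nonneg_right hV hN)
    rw [Finset.sum_mul]
    refine Finset.sum_le_sum fun i _ => (coeffNorm_smul_le _ _).trans ?_
    rw [← Complex.ofReal_sub, Complex.norm_real]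
    exact mul_le_mul_of_nonneg_left (hE _ _ _) (abs_nonneg _)

theorem norm_apply_le (hp : 1 ≤ p) (hE : IntervalProjectionBound X p E) (a : ℤ →₀ X) (n : ℤ) :
    ‖a n‖ ≤ E * coeffNorm p a := by
  have h := hE n (n + (1 : ℕ)) a
  rw [freqCut_Ico_eq_sum] at h
  simpa [coeffNorm_single hp] using h

end Multiplier

/-! ### Window weights of the negative binomial law -/

section WindowWeight

/-- The mass that `negBinWeight r`, truncated to `k < M`, puts on the interval `(n - L, n]`. -/
noncomputable def windowWeight (r M L : ℕ) (n : ℤ) : ℝ :=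
  ∑ j ∈ Finset.range L, ∑ k ∈ Finset.range M, if (j : ℤ) + k = n then negBinWeight r k else 0

theorem sum_ite_negBinWeight_le_one (r M l : ℕ) (u : ℤ) :
    ∑ i ∈ Finset.range l, ∑ k ∈ Finset.range M, (if u + k = i then negBinWeight r k else 0) ≤ 1 := by
  rw [Finset.sum_comm]
  refine le_trans (Finset.sum_le_sum fun k _ => ?_)
    (sum_le_hasSum (Finset.range M) (fun k _ => negBinWeight_nonneg r k) (hasSum_negBinWeight r))
  by_cases h : ∃ i : ℕ, u + k = i
  · obtain ⟨i, hi⟩ := h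
    rw [hi]
    simp only [Nat.cast_inj, Finset.sum_ite_eq]
    split_ifs
    · exact le_rfl
    · exact negBinWeight_nonneg r k
  · rw [Finset.sum_eq_zero fun i _ => if_neg fun hi => h ⟨i, hi⟩]
    exact negBinWeight_nonneg r k

/-- Moving the window by one gains the mass at `n + 1` and loses the mass at `n + 1 - L`. Summed
over `n`, the gains and the losses each total at most `1`, which yields the variation bound `2`. -/
theorem windowWeight_succ_sub (r M L : ℕ) (n : ℤ) :
    windowWeight r M L (n + 1) - windowWeight r M L n =
      (∑ k ∈ Finset.range M, if (k : ℤ) = n + 1 then negBinWeight r k else 0) -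
        ∑ k ∈ Finset.range M, if (L : ℤ) + k = n + 1 then negBinWeight r k else 0 := by
  have h := Finset.sum_range_sub' (fun j : ℕ =>
    ∑ k ∈ Finset.range M, if (j : ℤ) + k = n + 1 then negBinWeight r k else 0) L
  rw [Finset.sum_sub_distrib] at h
  simp only [Nat.cast_zero, zero_add] at h
  rw [← h, windowWeight, windowWeight]
  congr 1
  refine Finset.sum_congr rfl fun j _ => Finset.sum_congr rfl fun k _ => ?_
  refine if_congr ?_ rfl rfl
  push_cast
  omega

theorem sum_abs_windowWeight_succ_sub_le (r M L u l : ℕ) :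
    ∑ i ∈ Finset.range l,
      |windowWeight r M L ((u : ℤ) + (i + 1 : ℕ)) - windowWeight r M L ((u : ℤ) + i)| ≤ 2 := by
  have h1 := sum_ite_negBinWeight_le_one r M l (-(u : ℤ) - 1)
  have h2 := sum_ite_negBinWeight_le_one r M l ((L : ℤ) - u - 1)
  refine le_trans ?_ ((add_le_add h1 h2).trans_eq (by norm_num))
  rw [← Finset.sum_add_distrib]
  refine Finset.sum_le_sum fun i _ => ?_
  have hnn : ∀ (P : ℕ → Prop) [DecidablePred P],
      0 ≤ ∑ k ∈ Finset.range M, if P k then negBinWeight r k else 0 := fun P _ =>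
    Finset.sum_nonneg fun k _ => by
      split_ifs
      · exact negBinWeight_nonneg r k
      · exact le_rfl
  rw [Nat.cast_add, Nat.cast_one, ← add_assoc, windowWeight_succ_sub]
  refine (abs_sub _ _).trans (add_le_add ?_ ?_)
  · rw [abs_of_nonneg (hnn _)]
    exact le_of_eq (Finset.sum_congr rfl fun k _ => if_congr (by omega) rfl rfl)
  · rw [abs_of_nonneg (hnn _)]
    exact le_of_eq (Finset.sum_congr rfl fun k _ => if_congr (by omega) rfl rfl)

/-- With `n = r + s + i` and `i ≤ 2 s`, the window `(n - 4 s, n]` contains the whole Chebyshev range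
`(r - s, r + s)`. -/
theorem half_le_windowWeight {r s M i : ℕ} (hs : 0 < s) (hrs : 4 * r ≤ s ^ 2) (hM : r + s ≤ M)
    (hi : i ≤ 2 * s) : 1 / 2 ≤ windowWeight r M (4 * s) (((r + s : ℕ) : ℤ) + i) := by
  refine (half_le_sum_negBinWeight hs hrs hM).trans ?_
  rw [windowWeight, Finset.sum_comm, Finset.sum_filter]
  refine Finset.sum_le_sum fun k _ => ?_
  have hnn : ∀ j ∈ Finset.range (4 * s),
      0 ≤ if (j : ℤ) + k = ((r + s : ℕ) : ℤ) + i then negBinWeight r k else 0 := fun j _ => by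
    split_ifs
    · exact negBinWeight_nonneg r k
    · exact le_rfl
  split_ifs with hk
  · have := Finset.single_le_sum hnn (a := r + s + i - k) (Finset.mem_range.2 (by omega))
    rwa [if_pos (by omega)] at this
  · exact Finset.sum_nonneg hnn

/-- The reciprocals of the window weights have absolute value and total variation bounded by
absolute constants. -/
theorem abs_inv_windowWeight_le {r s M l : ℕ} (hs : 0 < s) (hrs : 4 * r ≤ s ^ 2) (hM : r + s ≤ M)
    (hl : l ≤ 2 * s) :
    |(windowWeight r M (4 * s) (((r + s : ℕ) : ℤ) + (l - 1 : ℕ)))⁻¹| ≤ 2 ∧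
      ∑ i ∈ Finset.range (l - 1), |(windowWeight r M (4 * s) (((r + s : ℕ) : ℤ) + (i + 1 : ℕ)))⁻¹ -
        (windowWeight r M (4 * s) (((r + s : ℕ) : ℤ) + i))⁻¹| ≤ 8 := by
  have hc : ∀ i : ℕ, i ≤ 2 * s → 1 / 2 ≤ windowWeight r M (4 * s) (((r + s : ℕ) : ℤ) + i) :=
    fun i hi => half_le_windowWeight hs hrs hM hi
  constructor
  · have h := hc (l - 1) (by omega)
    rw [abs_of_nonneg (inv_nonneg.2 (by linarith))]
    exact inv_le_of_inv_le₀ (by norm_num) (by linarith)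
  · have h := mul_le_mul_of_nonneg_left
      (sum_abs_windowWeight_succ_sub_le r M (4 * s) (r + s) (l - 1)) (by norm_num : (0 : ℝ) ≤ 4)
    refine le_trans ?_ (h.trans_eq (by norm_num))
    rw [Finset.mul_sum]
    refine Finset.sum_le_sum fun i hi => ?_
    have hi := Finset.mem_range.1 hi
    have h1 := hc i (by omega)
    have h2 := hc (i + 1) (by omega)
    set x := windowWeight r M (4 * s) (((r + s : ℕ) : ℤ) + i)
    set y := windowWeight r M (4 * s) (((r + s : ℕ) : ℤ) + (i + 1 : ℕ))
    rw [inv_sub_inv (by linarith) (by linarith), abs_div, abs_sub_comm x y,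
      abs_of_pos (mul_pos (by linarith : 0 < y) (by linarith : 0 < x)),
      div_le_iff₀ (mul_pos (by linarith : 0 < y) (by linarith : 0 < x))]
    -- Since `x, y ≥ 1 / 2`, taking reciprocals multiplies increments by at most `4`; this turns the
    -- variation `2` into `8`.
    have h3 : 1 ≤ 4 * (y * x) := by nlinarith
    nlinarith [abs_nonneg (y - x)]

end WindowWeight

/-! ### Action of the means on orbits and on pairings -/

section Kernel

variable {X : Type*} [NormedAddCommGroup X] [NormedSpace ℂ X] {p E K : ℝ} {T : X →L[ℂ] X}

/-- The action on coefficients of the truncated negative binomial mean of the operators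
`e_{εk} T^k`. -/
noncomputable def kernelAct (T : X →L[ℂ] X) (r M : ℕ) (ε : ℤ) (a : ℤ →₀ X) : ℤ →₀ X :=
  ∑ k ∈ Finset.range M, freqShift ((negBinWeight r k : ℂ) • T ^ k) (ε * k) a

theorem kernelAct_apply (r M : ℕ) (ε : ℤ) (a : ℤ →₀ X) (n : ℤ) :
    kernelAct T r M ε a n =
      ∑ k ∈ Finset.range M, (negBinWeight r k : ℂ) • (T ^ k) (a (n - ε * k)) := by
  rw [kernelAct, Finsupp.finsetSum_apply]
  exact Finset.sum_congr rfl fun k _ => by rw [freqShift_apply]; rfl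

theorem fourier_mul_natCast (ε : ℤ) (k : ℕ) (t : UnitAddCircle) :
    (fourier (ε * k) t : ℂ) = (fourier ε t : ℂ) ^ k := by
  induction k with
  | zero => simp
  | succ k ih => rw [Nat.cast_succ, mul_add, mul_one, fourier_add, ih, pow_succ]

/-- The truncation `M` may depend on `T`, but the bound does not. Both signs of `ε` are used: `1`
moves orbits forward, `-1` is the transposed action. -/
theorem exists_coeffNorm_kernelAct_le [CompleteSpace X] (hT : IsStronglyKreissBounded T K)
    (r M₀ : ℕ) : ∃ M, M₀ ≤ M ∧ ∀ (ε : ℤ) (a : ℤ →₀ X),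
      coeffNorm p (kernelAct T r M ε a) ≤ (|K| + 2) * coeffNorm p a := by
  obtain ⟨M, hM, h⟩ := exists_norm_sum_negBinWeight_le hT r M₀
  refine ⟨M, hM, fun ε a => coeffNorm_sum_freqShift_le _ _ _ (fun t => ?_) a⟩
  convert h (fourier ε t) (by rw [fourier_apply, Circle.norm_coe]) using 2
  refine Finset.sum_congr rfl fun k _ => ?_
  rw [smul_smul, fourier_mul_natCast, mul_comm]

/-- For `r = 1` the law is geometric, and `T ^ j x` is read off as a Fourier coefficient of the mean
applied to the constant `x`. This crude bound, uniform in `T`, starts the recursion and covers small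
`n`. -/
theorem norm_pow_le_of_isStronglyKreissBounded [CompleteSpace X] (hp : 1 ≤ p)
    (hE : IntervalProjectionBound X p E) (hE0 : 0 ≤ E) (hT : IsStronglyKreissBounded T K) (j : ℕ) :
    ‖T ^ j‖ ≤ 2 ^ (j + 1) * (E * (|K| + 2)) := by
  obtain ⟨M, hM, h⟩ := exists_coeffNorm_kernelAct_le (p := p) hT 1 (j + 1)
  refine ContinuousLinearMap.opNorm_le_bound _ (by positivity) fun x => ?_
  have h1 := norm_apply_le hp hE (kernelAct T 1 M 1 (Finsupp.single 0 x)) j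
  have h2 : kernelAct T 1 M 1 (Finsupp.single 0 x) j = (negBinWeight 1 j : ℂ) • (T ^ j) x := by
    rw [kernelAct_apply, Finset.sum_eq_single j]
    · simp
    · intro k _ hk
      rw [Finsupp.single_eq_of_ne (by omega), map_zero, smul_zero]
    · intro hj
      exact absurd (Finset.mem_range.2 (by omega)) hj
  rw [h2, norm_smul, Complex.norm_real, negBinWeight, Nat.multichoose_one,
    Real.norm_of_nonneg (by positivity), Nat.cast_one, one_div_mul_eq_div,
    div_le_iff₀ (by positivity)] at h1
  have h3 := h 1 (Finsupp.single 0 x)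
  rw [coeffNorm_single hp] at h3
  calc ‖(T ^ j) x‖ ≤ E * coeffNorm p (kernelAct T 1 M 1 (Finsupp.single 0 x)) * 2 ^ (1 + j) := h1
    _ ≤ E * ((|K| + 2) * ‖x‖) * 2 ^ (1 + j) := by gcongr
    _ = _ := by rw [add_comm 1 j]; ring

/-- The coefficients of `∑ j < L, e_j T^j x`. -/
noncomputable def orbitCoeff (T : X →L[ℂ] X) (L : ℕ) (x : X) : ℤ →₀ X :=
  ∑ j ∈ Finset.range L, Finsupp.single (j : ℤ) ((T ^ j) x)

/-- The pairing of a trigonometric polynomial with `∑ j < L, e_{-j} T^j`. -/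
noncomputable def orbitPairing (T : X →L[ℂ] X) (L : ℕ) (a : ℤ →₀ X) : X :=
  ∑ j ∈ Finset.range L, (T ^ j) (a j)

/-- Every pair `j + k = n` contributes a multiple of the same vector `T ^ n x`, so only a scalar
weight remains. -/
theorem kernelAct_orbitCoeff_apply (r M L n : ℕ) (x : X) :
    kernelAct T r M 1 (orbitCoeff T L x) n = (windowWeight r M L n : ℂ) • (T ^ n) x := by
  rw [kernelAct_apply, windowWeight, Finset.sum_comm, Complex.ofReal_sum, Finset.sum_smul]
  refine Finset.sum_congr rfl fun k _ => ?_
  rw [orbitCoeff, sum_single_apply, map_sum, Finset.smul_sum, Complex.ofReal_sum, Finset.sum_smul]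
  refine Finset.sum_congr rfl fun j _ => ?_
  by_cases h : (j : ℤ) + k = n
  · have hn : n = k + j := by omega
    rw [if_pos h, if_pos (by omega), hn, pow_add]
    rfl
  · rw [if_neg h, if_neg (by omega), map_zero, smul_zero, Complex.ofReal_zero, zero_smul]

/-- The transpose of `kernelAct_orbitCoeff_apply`: `ε = -1` brings frequency `u + i` down to `j = u
+ i - k`, and `T ^ j T ^ k` restores the exponent. -/
theorem orbitPairing_kernelAct (r M L u l : ℕ) (x : ℕ → X) :
    orbitPairing T L (kernelAct T r M (-1)
      (∑ i ∈ Finset.range l, Finsupp.single ((u : ℤ) + i) (x i))) =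
      ∑ i ∈ Finset.range l, (windowWeight r M L ((u : ℤ) + i) : ℂ) • (T ^ (u + i)) (x i) := by
  have h1 : ∀ j k : ℕ, (T ^ j) ((negBinWeight r k : ℂ) • (T ^ k)
      ((∑ i ∈ Finset.range l, Finsupp.single ((u : ℤ) + i) (x i)) (j - -1 * k))) =
      ∑ i ∈ Finset.range l, ((if (j : ℤ) + k = u + i then negBinWeight r k else 0 : ℝ) : ℂ) •
        (T ^ (u + i)) (x i) := by
    intro j k
    rw [sum_single_apply, map_sum, map_smul, map_sum, Finset.smul_sum]
    refine Finset.sum_congr rfl fun i _ => ?_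
    by_cases h : (j : ℤ) + k = u + i
    · have hn : u + i = j + k := by omega
      rw [if_pos h, if_pos (by omega), hn, pow_add]
      rfl
    · rw [if_neg h, if_neg (by omega), map_zero, map_zero, smul_zero, Complex.ofReal_zero,
        zero_smul]
  simp only [orbitPairing, kernelAct_apply, map_sum, h1]
  simp only [windowWeight, Complex.ofReal_sum, Finset.sum_smul]
  exact (Finset.sum_congr rfl fun j _ => Finset.sum_comm).trans Finset.sum_comm

end Kernel

/-! ### Orbit windows near time `r` -/

section Window

variable {X : Type*} [NormedAddCommGroup X] [NormedSpace ℂ X] {p E K : ℝ} {T : X →L[ℂ] X}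

/-- A piece of an orbit near time `r` of length at most `√r` is no larger than the initial piece of
comparable length. -/
theorem coeffNorm_orbit_window_le [CompleteSpace X] (hp : 1 ≤ p)
    (hE : IntervalProjectionBound X p E) (hE0 : 0 ≤ E) (hT : IsStronglyKreissBounded T K)
    {r s l : ℕ} (hs : 0 < s) (hrs : 4 * r ≤ s ^ 2) (hl : l ≤ 2 * s) (x : X) :
    coeffNorm p (∑ i ∈ Finset.range l,
      Finsupp.single (((r + s : ℕ) : ℤ) + i) ((T ^ (r + s + i)) x)) ≤
      10 * E * (|K| + 2) * coeffNorm p (orbitCoeff T (4 * s) x) := by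
  obtain ⟨M, hM, h⟩ := exists_coeffNorm_kernelAct_le (p := p) hT r (r + s)
  obtain ⟨hA, hV⟩ := abs_inv_windowWeight_le hs hrs hM hl
  have h1 := coeffNorm_sum_single_smul_le hp hE ((r + s : ℕ) : ℤ) l
    (fun i => (windowWeight r M (4 * s) (((r + s : ℕ) : ℤ) + i))⁻¹) hA hV
    (kernelAct T r M 1 (orbitCoeff T (4 * s) x))
  have h2 : ∀ i ∈ Finset.range l, Finsupp.single (((r + s : ℕ) : ℤ) + i)
      ((((windowWeight r M (4 * s) (((r + s : ℕ) : ℤ) + i))⁻¹ : ℝ) : ℂ) •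
        kernelAct T r M 1 (orbitCoeff T (4 * s) x) (((r + s : ℕ) : ℤ) + i)) =
      Finsupp.single (((r + s : ℕ) : ℤ) + i) ((T ^ (r + s + i)) x) := by
    intro i hi
    have hi := Finset.mem_range.1 hi
    have hc := half_le_windowWeight hs hrs hM (i := i) (by omega)
    rw [← Nat.cast_add (r + s) i] at hc ⊢
    rw [kernelAct_orbitCoeff_apply, smul_smul, ← Complex.ofReal_mul,
      inv_mul_cancel₀ (by linarith), Complex.ofReal_one, one_smul]
  rw [Finset.sum_congr rfl h2] at h1
  refine h1.trans ?_
  have h3 := h 1 (orbitCoeff T (4 * s) x)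
  calc (2 + 8) * (E * coeffNorm p (kernelAct T r M 1 (orbitCoeff T (4 * s) x)))
      ≤ (2 + 8) * (E * ((|K| + 2) * coeffNorm p (orbitCoeff T (4 * s) x))) := by gcongr
    _ = _ := by ring

/-- The transposed order of operations: divide the coefficients by the window weights, apply the
mean with `ε = -1`, then pair with the initial orbit piece. -/
theorem norm_sum_orbit_window_le [CompleteSpace X] (hp : 1 ≤ p)
    (hE : IntervalProjectionBound X p E) (hT : IsStronglyKreissBounded T K)
    {r s l : ℕ} (hs : 0 < s) (hrs : 4 * r ≤ s ^ 2) (hl : l ≤ 2 * s) {S : ℝ} (hS0 : 0 ≤ S)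
    (hS : ∀ a, ‖orbitPairing T (4 * s) a‖ ≤ S * coeffNorm p a) (a : ℤ →₀ X) :
    ‖∑ i ∈ Finset.range l, (T ^ (r + s + i)) (a (((r + s : ℕ) : ℤ) + i))‖ ≤
      10 * E * (|K| + 2) * S * coeffNorm p a := by
  obtain ⟨M, hM, h⟩ := exists_coeffNorm_kernelAct_le (p := p) hT r (r + s)
  obtain ⟨hA, hV⟩ := abs_inv_windowWeight_le hs hrs hM hl
  have h1 := coeffNorm_sum_single_smul_le hp hE ((r + s : ℕ) : ℤ) l
    (fun i => (windowWeight r M (4 * s) (((r + s : ℕ) : ℤ) + i))⁻¹) hA hV a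
  have h2 := orbitPairing_kernelAct (T := T) r M (4 * s) (r + s) l fun i =>
    (((windowWeight r M (4 * s) (((r + s : ℕ) : ℤ) + i))⁻¹ : ℝ) : ℂ) •
      a (((r + s : ℕ) : ℤ) + i)
  have h3 : ∀ i ∈ Finset.range l, (windowWeight r M (4 * s) (((r + s : ℕ) : ℤ) + i) : ℂ) •
      (T ^ (r + s + i)) ((((windowWeight r M (4 * s) (((r + s : ℕ) : ℤ) + i))⁻¹ : ℝ) : ℂ) •
        a (((r + s : ℕ) : ℤ) + i)) = (T ^ (r + s + i)) (a (((r + s : ℕ) : ℤ) + i)) := by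
    intro i hi
    have hi := Finset.mem_range.1 hi
    have hc := half_le_windowWeight hs hrs hM (i := i) (by omega)
    rw [map_smul, smul_smul, ← Complex.ofReal_mul, mul_inv_cancel₀ (by linarith),
      Complex.ofReal_one, one_smul]
  rw [Finset.sum_congr rfl h3] at h2
  rw [← h2]
  refine (hS _).trans ?_
  refine (mul_le_mul_of_nonneg_left (h (-1) _) hS0).trans ?_
  have hK : 0 ≤ |K| + 2 := by positivity
  refine (mul_le_mul_of_nonneg_left (mul_le_mul_of_nonneg_left h1 hK) hS0).trans_eq ?_
  ring

end Window

/-! ### One step from length `64 μ` to length `64 μ ^ 2` -/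

section Blocks

variable {X : Type*} [NormedAddCommGroup X] [NormedSpace ℂ X] {p E K : ℝ} {T : X →L[ℂ] X}

/-- The block `[s i, s (i + 1))` of frequencies. -/
def freqBlock (s i : ℕ) : Set ℤ := Set.Ico ((s * i : ℕ) : ℤ) (((s * i : ℕ) : ℤ) + s)

variable (X) in
/-- Upper decomposition over `m` consecutive blocks of equal length. -/
def UpperBlockBound (p θ U : ℝ) : Prop :=
  ∀ s m : ℕ, 0 < s → 0 < m → ∀ a : ℤ →₀ X, (∀ n ∉ Set.Ico (0 : ℤ) (s * m : ℕ), a n = 0) →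
    ∀ B : ℝ, (∀ i < m, coeffNorm p (freqCut (freqBlock s i) a) ≤ B) →
      coeffNorm p a ≤ U * (m : ℝ) ^ θ * B

variable (X) in
/-- Lower decomposition over `m` consecutive blocks of equal length. -/
def LowerBlockBound (p θ L : ℝ) : Prop :=
  ∀ s m : ℕ, 0 < s → 0 < m → ∀ a : ℤ →₀ X, (∀ n ∉ Set.Ico (0 : ℤ) (s * m : ℕ), a n = 0) →
    ∑ i ∈ Finset.range m, coeffNorm p (freqCut (freqBlock s i) a) ≤
      L * (m : ℝ) ^ θ * coeffNorm p a

variable (p T) in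
/-- `S` bounds the `L^p` norm of the orbit pieces `∑ j < L, e_j T^j x`. -/
def OrbitBound (L : ℕ) (S : ℝ) : Prop := ∀ x, coeffNorm p (orbitCoeff T L x) ≤ S * ‖x‖

variable (p T) in
/-- `S` bounds the pairing with `∑ j < L, e_{-j} T^j` on `L^p`. -/
def PairingBound (L : ℕ) (S : ℝ) : Prop := ∀ a, ‖orbitPairing T L a‖ ≤ S * coeffNorm p a

theorem orbitCoeff_apply {L j : ℕ} (hj : j < L) (x : X) : orbitCoeff T L x j = (T ^ j) x := by
  have h := sum_range_single_add_apply 0 hj fun j => (T ^ j) x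
  simpa only [orbitCoeff, zero_add] using h

theorem orbitCoeff_apply_of_notMem {L : ℕ} {n : ℤ} (hn : n ∉ Set.Ico (0 : ℤ) L) (x : X) :
    orbitCoeff T L x n = 0 := by
  have h := sum_range_single_add_apply_of_notMem (u := 0) (l := L) (by rwa [zero_add])
    fun j => (T ^ j) x
  simpa only [orbitCoeff, zero_add] using h

theorem freqCut_orbitCoeff {u l L : ℕ} (h : u + l ≤ L) (x : X) :
    freqCut (Set.Ico (u : ℤ) (u + l)) (orbitCoeff T L x) =
      ∑ i ∈ Finset.range l, Finsupp.single ((u : ℤ) + i) ((T ^ (u + i)) x) := by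
  rw [freqCut_Ico_eq_sum]
  refine Finset.sum_congr rfl fun i hi => ?_
  have hi := Finset.mem_range.1 hi
  rw [← Nat.cast_add, orbitCoeff_apply (by omega)]

theorem freqCut_orbitCoeff_zero {l L : ℕ} (h : l ≤ L) (x : X) :
    freqCut (Set.Ico (0 : ℤ) l) (orbitCoeff T L x) = orbitCoeff T l x := by
  have := freqCut_orbitCoeff (T := T) (u := 0) (l := l) (L := L) (by omega) x
  simpa only [orbitCoeff, Nat.cast_zero, zero_add] using this

theorem orbitPairing_freqCut_zero {l L : ℕ} (h : l ≤ L) (a : ℤ →₀ X) :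
    orbitPairing T L (freqCut (Set.Ico (0 : ℤ) l) a) = orbitPairing T l a := by
  unfold orbitPairing
  rw [← Finset.sum_range_add_sum_Ico _ h, Finset.sum_eq_zero (s := Finset.Ico l L), add_zero]
  · refine Finset.sum_congr rfl fun j hj => ?_
    have hj := Finset.mem_range.1 hj
    rw [freqCut_apply_of_mem (Set.mem_Ico.2 ⟨by omega, by omega⟩)]
  · intro j hj
    have hj := Finset.mem_Ico.1 hj
    rw [freqCut_apply_of_notMem (by rw [Set.mem_Ico]; omega), map_zero]

theorem OrbitBound.mono_right {L : ℕ} {S S' : ℝ} (h : OrbitBound p T L S) (hS : S ≤ S') :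
    OrbitBound p T L S' :=
  fun x => (h x).trans (mul_le_mul_of_nonneg_right hS (norm_nonneg x))

theorem PairingBound.mono_right {L : ℕ} {S S' : ℝ} (h : PairingBound p T L S) (hS : S ≤ S') :
    PairingBound p T L S' :=
  fun x => (h x).trans (mul_le_mul_of_nonneg_right hS (coeffNorm_nonneg x))

theorem OrbitBound.mono_left (hE : IntervalProjectionBound X p E) (hE0 : 0 ≤ E) {L L' : ℕ} {S : ℝ}
    (hL : L ≤ L') (h : OrbitBound p T L' S) : OrbitBound p T L (E * S) := fun x => by
  rw [← freqCut_orbitCoeff_zero hL, mul_assoc]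
  exact (hE _ _ _).trans (mul_le_mul_of_nonneg_left (h x) hE0)

theorem PairingBound.mono_left (hE : IntervalProjectionBound X p E) {L L' : ℕ} {S : ℝ}
    (hS : 0 ≤ S) (hL : L ≤ L') (h : PairingBound p T L' S) : PairingBound p T L (E * S) :=
  fun a => by
  rw [← orbitPairing_freqCut_zero hL, mul_comm E, mul_assoc]
  exact (h _).trans (mul_le_mul_of_nonneg_left (hE _ _ _) hS)

theorem orbitBound_of_norm_pow (hp : 1 ≤ p) (L : ℕ) :
    OrbitBound p T L (∑ j ∈ Finset.range L, ‖T ^ j‖) := fun x => by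
  refine (coeffNorm_sum_le hp _ _).trans ?_
  rw [Finset.sum_mul]
  refine Finset.sum_le_sum fun j _ => ?_
  rw [coeffNorm_single hp]
  exact (T ^ j).le_opNorm x

theorem pairingBound_of_norm_pow (hp : 1 ≤ p) (hE : IntervalProjectionBound X p E) (L : ℕ) :
    PairingBound p T L (E * ∑ j ∈ Finset.range L, ‖T ^ j‖) := fun a => by
  refine (norm_sum_le _ _).trans ?_
  rw [mul_comm E, mul_assoc, Finset.sum_mul]
  refine Finset.sum_le_sum fun j _ => ?_
  exact ((T ^ j).le_opNorm _).trans
    (mul_le_mul_of_nonneg_left (norm_apply_le hp hE a j) (norm_nonneg _))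

/-- Cut `[0, 64 μ ^ 2)` into `4 μ` blocks of length `s = 16 μ`. Block `j + 1` starts at `r + s` with
`r = s j`, and `j ≤ 4 μ` gives `4 r ≤ s ^ 2`; so each block is bounded by the initial piece of
length `4 s = 64 μ`. -/
theorem OrbitBound.step [CompleteSpace X] {θ U : ℝ} (hp : 1 ≤ p)
    (hE : IntervalProjectionBound X p E) (hE0 : 0 ≤ E) (hU : UpperBlockBound X p θ U)
    (hT : IsStronglyKreissBounded T K) {μ : ℕ} (hμ : 0 < μ) {S : ℝ}
    (h : OrbitBound p T (64 * μ) S) :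
    OrbitBound p T (64 * μ ^ 2) (U * ((4 * μ : ℕ) : ℝ) ^ θ * (10 * E * (|K| + 2) * S)) := by
  intro x
  rw [mul_assoc]
  have hL : 64 * μ ^ 2 = 16 * μ * (4 * μ) := by ring
  refine hU (16 * μ) (4 * μ) (by omega) (by omega) _ (fun n hn => ?_) _ fun i hi => ?_
  · rw [← hL] at hn
    exact orbitCoeff_apply_of_notMem hn x
  have hx := h x
  have h1 : 16 * μ * i + 16 * μ ≤ 64 * μ ^ 2 := by
    rw [hL, ← Nat.mul_succ]
    exact Nat.mul_le_mul_left _ hi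
  rw [freqBlock, freqCut_orbitCoeff h1]
  -- Windows begin at time `s` at the earliest, so block `0` is handled by projecting the initial
  -- piece directly.
  rcases Nat.eq_zero_or_pos i with rfl | hi0
  · have h2 := freqCut_orbitCoeff_zero (T := T) (l := 16 * μ) (L := 64 * μ) (by omega) x
    have h3 := hE 0 (16 * μ : ℕ) (orbitCoeff T (64 * μ) x)
    rw [h2] at h3
    simp only [mul_zero, zero_add, Nat.cast_zero]
    refine h3.trans ((mul_le_mul_of_nonneg_left hx hE0).trans ?_)
    have h4 : 0 ≤ E * (S * ‖x‖) := mul_nonneg hE0 ((coeffNorm_nonneg _).trans hx)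
    nlinarith [mul_nonneg h4 (abs_nonneg K)]
  · obtain ⟨j, rfl⟩ := Nat.exists_eq_succ_of_ne_zero hi0.ne'
    have h2 := coeffNorm_orbit_window_le hp hE hE0 hT (r := 16 * μ * j) (s := 16 * μ) (l := 16 * μ)
      (by omega) (by nlinarith) (by omega) x
    rw [← Nat.mul_succ] at h2
    refine h2.trans ?_
    rw [show 4 * (16 * μ) = 64 * μ by ring, mul_assoc _ S]
    exact mul_le_mul_of_nonneg_left hx (by positivity)

theorem sum_range_mul {M : Type*} [AddCommMonoid M] (f : ℕ → M) (s m : ℕ) :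
    ∑ j ∈ Finset.range (s * m), f j =
      ∑ i ∈ Finset.range m, ∑ k ∈ Finset.range s, f (s * i + k) := by
  induction m with
  | zero => simp
  | succ m ih => rw [Nat.mul_succ, Finset.sum_range_add, ih, Finset.sum_range_succ]

/-- Same blocks as in `OrbitBound.step`. The block contributions are added by the triangle
inequality, and the lower decomposition bounds the sum of the block norms of `a`; cutting `a` down
to `[0, 64 μ ^ 2)` costs the extra factor `E`. -/
theorem PairingBound.step [CompleteSpace X] {θ L : ℝ} (hp : 1 ≤ p)
    (hE : IntervalProjectionBound X p E) (hE1 : 1 ≤ E) (hL : LowerBlockBound X p θ L) (hL0 : 0 ≤ L)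
    (hT : IsStronglyKreissBounded T K) {μ : ℕ} (hμ : 0 < μ) {S : ℝ} (hS : 0 ≤ S)
    (h : PairingBound p T (64 * μ) S) :
    PairingBound p T (64 * μ ^ 2)
      (L * E * ((4 * μ : ℕ) : ℝ) ^ θ * (10 * E * (|K| + 2) * S)) := by
  intro a
  have hN : 64 * μ ^ 2 = 16 * μ * (4 * μ) := by ring
  set b := freqCut (Set.Ico (0 : ℤ) (64 * μ ^ 2 : ℕ)) a with hb
  have hE0 : 0 ≤ E := by linarith
  have hcut := hL (16 * μ) (4 * μ) (by omega) (by omega) b fun n hn => by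
    rw [← hN] at hn
    exact freqCut_apply_of_notMem hn a
  have hblock : ∀ i < 4 * μ,
      ‖∑ k ∈ Finset.range (16 * μ), (T ^ (16 * μ * i + k)) (b (16 * μ * i + k : ℕ))‖ ≤
        10 * E * (|K| + 2) * S * coeffNorm p (freqCut (freqBlock (16 * μ) i) b) := by
    intro i hi
    have h0 : ∀ k ∈ Finset.range (16 * μ), (T ^ (16 * μ * i + k)) (b (16 * μ * i + k : ℕ)) =
        (T ^ (16 * μ * i + k)) (freqCut (freqBlock (16 * μ) i) b
          (((16 * μ * i : ℕ) : ℤ) + k)) := by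
      intro k hk
      have hk := Finset.mem_range.1 hk
      have hm : ((16 * μ * i : ℕ) : ℤ) + k ∈ freqBlock (16 * μ) i :=
        Set.mem_Ico.2 ⟨by omega, by omega⟩
      rw [freqCut_apply_of_mem hm b, Nat.cast_add]
    rw [Finset.sum_congr rfl h0]
    set c := freqCut (freqBlock (16 * μ) i) b
    rcases Nat.eq_zero_or_pos i with rfl | hi0
    · have h1 := (h.mono_left hE hS (by omega : 16 * μ ≤ 64 * μ)) c
      simp only [mul_zero, zero_add, Nat.cast_zero]
      refine h1.trans (mul_le_mul_of_nonneg_right ?_ (coeffNorm_nonneg _))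
      have h4 : 0 ≤ E * S := mul_nonneg hE0 hS
      nlinarith [mul_nonneg h4 (abs_nonneg K)]
    · obtain ⟨j, rfl⟩ := Nat.exists_eq_succ_of_ne_zero hi0.ne'
      have h2 := norm_sum_orbit_window_le hp hE hT (r := 16 * μ * j) (s := 16 * μ) (l := 16 * μ)
        (by omega) (by nlinarith) (by omega) hS
        (by rwa [show 4 * (16 * μ) = 64 * μ by ring]) c
      rwa [← Nat.mul_succ] at h2
  rw [← orbitPairing_freqCut_zero le_rfl, ← hb, orbitPairing, hN, sum_range_mul]
  refine (norm_sum_le _ _).trans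
    ((Finset.sum_le_sum fun i hi => hblock i (Finset.mem_range.1 hi)).trans ?_)
  rw [← Finset.mul_sum]
  have hC : 0 ≤ 10 * E * (|K| + 2) * S := by positivity
  refine (mul_le_mul_of_nonneg_left (hcut.trans
    (mul_le_mul_of_nonneg_left (hE _ _ _) (by positivity))) hC).trans_eq ?_
  ring

end Blocks

/-! ### Square-root recursion -/

section Recursion

/-- The square-root recursion, in which the number of steps is doubly logarithmic. -/
theorem square_root_recursion {P : ℕ → ℝ → Prop} {θ A E C : ℝ} (hθ : 0 ≤ θ) (hA : 1 ≤ A)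
    (hE : 1 ≤ E) (hC : 0 ≤ C)
    (mono_right : ∀ {L S S'}, P L S → S ≤ S' → P L S')
    (mono_left : ∀ {L L' S}, 0 ≤ S → L ≤ L' → P L' S → P L (E * S))
    (base : P 128 C)
    (step : ∀ {μ S}, 0 < μ → 0 ≤ S → P (64 * μ) S → P (64 * μ ^ 2) (A * (μ : ℝ) ^ θ * S)) (k : ℕ) :
    ∀ l : ℕ, 1 ≤ l → l ≤ 2 ^ 2 ^ k →
      P (64 * l) (E * C * (E * A * 4 ^ θ) ^ k * (l : ℝ) ^ θ) := by
  induction k with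
  | zero =>
    intro l hl1 hl2
    norm_num at hl2
    refine mono_right (mono_left hC (by omega : 64 * l ≤ 128) base) ?_
    have : 1 ≤ (l : ℝ) ^ θ := Real.one_le_rpow (by exact_mod_cast hl1) hθ
    rw [pow_zero, mul_one]
    exact le_mul_of_one_le_right (by positivity) this
  | succ k ih =>
    intro l hl1 hl2
    obtain ⟨μ, hμ0, hμ1, hμ2, hμ3⟩ : ∃ μ : ℕ, 0 < μ ∧ l ≤ μ ^ 2 ∧ μ ^ 2 ≤ 4 * l ∧
        μ ≤ 2 ^ 2 ^ k := by
      -- This is `√l` rounded up. Rounding up makes `64 μ ^ 2` cover `64 l`, and `μ` stays within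
      -- the range of the induction hypothesis.
      refine ⟨Nat.sqrt (l - 1) + 1, by omega, ?_, ?_, ?_⟩
      · have := Nat.lt_succ_sqrt' (l - 1)
        rw [Nat.succ_eq_add_one] at this
        omega
      · have := Nat.sqrt_le' (l - 1)
        have h2 : Nat.sqrt (l - 1) ^ 2 + 1 ≤ l := by omega
        nlinarith [sq_nonneg ((Nat.sqrt (l - 1) : ℤ) - 1)]
      · rw [Nat.succ_le_iff, Nat.sqrt_lt']
        rw [pow_succ, pow_mul] at hl2
        omega
    have hpos : (0 : ℝ) < 4 ^ θ := Real.rpow_pos_of_pos (by norm_num) θ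
    have h1 := ih μ hμ0 hμ3
    have h2 := step hμ0 (by positivity) h1
    refine mono_right (mono_left (by positivity) (Nat.mul_le_mul_left 64 hμ1) h2) ?_
    -- One factor `μ ^ θ` is the cost of the step, the other the inductive bound; together they
    -- reproduce the power `l ^ θ` without loss in the exponent.
    have h3 : (μ : ℝ) ^ θ * (μ : ℝ) ^ θ ≤ 4 ^ θ * (l : ℝ) ^ θ := by
      rw [← Real.mul_rpow (by positivity) (by positivity),
        ← Real.mul_rpow (by positivity) (by positivity)]
      refine Real.rpow_le_rpow (by positivity) ?_ hθ
      rw [← sq]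
      exact_mod_cast hμ2
    calc E * (A * (μ : ℝ) ^ θ * (E * C * (E * A * 4 ^ θ) ^ k * (μ : ℝ) ^ θ))
        = E * A * (E * C * (E * A * 4 ^ θ) ^ k) * ((μ : ℝ) ^ θ * (μ : ℝ) ^ θ) := by ring
      _ ≤ E * A * (E * C * (E * A * 4 ^ θ) ^ k) * (4 ^ θ * (l : ℝ) ^ θ) := by gcongr
      _ = _ := by ring

/-- Two nested binary logarithms, rounded up. The second bound makes `Q ^ k` a power of the
logarithm for any fixed `Q`. -/
theorem exists_le_two_pow_two_pow (n : ℕ) (hn : 1 ≤ n) :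
    ∃ k : ℕ, n ≤ 2 ^ 2 ^ k ∧ (2 : ℝ) ^ k ≤ 8 * Real.log ((n : ℝ) + 2) := by
  have hn' : (1 : ℝ) ≤ n := by exact_mod_cast hn
  have hlog2 : Real.log 2 ≤ Real.log ((n : ℝ) + 2) := Real.log_le_log (by norm_num) (by linarith)
  have hl2 := Real.log_two_gt_d9
  have hclog : ((Nat.clog 2 n : ℕ) : ℝ) ≤ 1 + 2 * Real.log ((n : ℝ) + 2) := by
    rcases Nat.eq_zero_or_pos (Nat.clog 2 n) with h0 | h0
    · rw [h0]; push_cast; linarith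
    · have h1 : 2 ^ (Nat.clog 2 n - 1) < n := Nat.pow_lt_of_lt_clog (by omega)
      have h2 : (2 : ℝ) ^ (Nat.clog 2 n - 1) ≤ (n : ℝ) + 2 := by
        have : (2 : ℝ) ^ (Nat.clog 2 n - 1) < n := by exact_mod_cast h1
        linarith
      have h3 := Real.log_le_log (by positivity) h2
      rw [Real.log_pow, Nat.cast_sub h0] at h3
      push_cast at h3
      have h4 : (0 : ℝ) ≤ (Nat.clog 2 n : ℝ) - 1 := by
        have : (1 : ℝ) ≤ (Nat.clog 2 n : ℝ) := by exact_mod_cast h0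
        linarith
      nlinarith
  refine ⟨Nat.clog 2 (Nat.clog 2 n), (Nat.le_pow_clog (by norm_num) n).trans
    (Nat.pow_le_pow_right (by norm_num) (Nat.le_pow_clog (by norm_num) _)), ?_⟩
  rcases Nat.eq_zero_or_pos (Nat.clog 2 (Nat.clog 2 n)) with h0 | h0
  · rw [h0]; linarith
  · have h1 : 2 ^ (Nat.clog 2 (Nat.clog 2 n) - 1) < Nat.clog 2 n :=
      Nat.pow_lt_of_lt_clog (by omega)
    have h2 : (2 : ℝ) ^ (Nat.clog 2 (Nat.clog 2 n) - 1) < (Nat.clog 2 n : ℕ) := by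
      exact_mod_cast h1
    obtain ⟨j, hj⟩ := Nat.exists_eq_succ_of_ne_zero h0.ne'
    rw [hj] at h2 ⊢
    rw [Nat.succ_sub_one] at h2
    rw [pow_succ]
    linarith

end Recursion

/-! ### From orbit and pairing bounds to powers of `T` -/

section Growth

variable {X : Type*} [NormedAddCommGroup X] [NormedSpace ℂ X] {p E K : ℝ} {T : X →L[ℂ] X}

theorem IntervalProjectionBound.mono {E' : ℝ} (h : IntervalProjectionBound X p E) (hE : E ≤ E') :
    IntervalProjectionBound X p E' :=
  fun u v a => (h u v a).trans (mul_le_mul_of_nonneg_right hE (coeffNorm_nonneg a))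

/-- Reflection at `n` aligns `T ^ (u + i) x` with `T ^ (n - u - i)`. The two inequalities keep these
complementary exponents in `[0, s)`, so each of the `l` terms yields `T ^ n x`. -/
theorem orbitPairing_freqReflect (s n u l : ℕ) (h1 : u + l ≤ n) (h2 : n < u + s) (x : X) :
    orbitPairing T s (freqReflect n
      (∑ i ∈ Finset.range l, Finsupp.single ((u : ℤ) + i) ((T ^ (u + i)) x))) =
      l • (T ^ n) x := by
  have h : ∀ j : ℕ, (T ^ j) (freqReflect n
      (∑ i ∈ Finset.range l, Finsupp.single ((u : ℤ) + i) ((T ^ (u + i)) x)) j) =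
      ∑ i ∈ Finset.range l, if j = n - u - i then (T ^ n) x else 0 := by
    intro j
    rw [freqReflect_apply, sum_single_apply, map_sum]
    refine Finset.sum_congr rfl fun i hi => ?_
    have hi := Finset.mem_range.1 hi
    by_cases hj : j = n - u - i
    · have hn : n = j + (u + i) := by omega
      rw [if_pos hj, if_pos (by omega), hn, pow_add T j (u + i)]
      rfl
    · rw [if_neg hj, if_neg (by omega), map_zero]
  simp only [orbitPairing, h]
  rw [Finset.sum_comm, Finset.sum_congr rfl (g := fun _ => (T ^ n) x), Finset.sum_const,
    Finset.card_range]
  intro i _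
  rw [Finset.sum_ite_eq', if_pos (Finset.mem_range.2 (by omega))]

theorem mul_norm_pow_le [CompleteSpace X] (hp : 1 ≤ p)
    (hE : IntervalProjectionBound X p E) (hE0 : 0 ≤ E) (hT : IsStronglyKreissBounded T K)
    {n μ : ℕ} (hμ : 0 < μ) (h48 : 48 * μ ≤ n) (hn : n ≤ μ ^ 2) {S₀ S₁ : ℝ}
    (hS₀ : 0 ≤ S₀) (hS₁ : 0 ≤ S₁) (h₀ : OrbitBound p T (64 * μ) S₀)
    (h₁ : PairingBound p T (64 * μ) S₁) :
    32 * (μ : ℝ) * ‖T ^ n‖ ≤ S₁ * (10 * E * (|K| + 2) * S₀) := by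
  have hμ' : (0 : ℝ) < 32 * μ := by positivity
  rw [← le_div_iff₀' hμ']
  refine ContinuousLinearMap.opNorm_le_bound _ (by positivity) fun x => ?_
  rw [div_mul_eq_mul_div, le_div_iff₀' hμ']
  -- The window is `[n - 32 μ, n)`: it starts at `r + s` and has the maximal length `2 s`. The
  -- complementary exponents are at most `32 μ`, within the pairing length `64 μ`.
  have hw := coeffNorm_orbit_window_le hp hE hE0 hT (r := n - 48 * μ) (s := 16 * μ) (l := 32 * μ)
    (by omega) (by nlinarith [Nat.sub_le n (48 * μ)]) (by omega) x
  rw [show 4 * (16 * μ) = 64 * μ by ring] at hw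
  have h2 := h₁ (freqReflect n (∑ i ∈ Finset.range (32 * μ),
    Finsupp.single (((n - 48 * μ + 16 * μ : ℕ) : ℤ) + i) ((T ^ (n - 48 * μ + 16 * μ + i)) x)))
  rw [coeffNorm_freqReflect, orbitPairing_freqReflect _ _ _ _ (by omega) (by omega),
    ← Nat.cast_smul_eq_nsmul ℂ, norm_smul, Complex.norm_natCast, Nat.cast_mul] at h2
  refine h2.trans ?_
  rw [mul_assoc S₁, mul_assoc _ S₀]
  exact mul_le_mul_of_nonneg_left (hw.trans (mul_le_mul_of_nonneg_left (h₀ x) (by positivity))) hS₁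

/-- The sign of `e` is left open: the upper bound on `y ^ 2` serves `e ≥ 0`, the lower bound `e ≤
0`. -/
theorem rpow_le_of_sq_comparable {x y : ℝ} (hx : 0 < x) (hy : 0 < y) (h1 : x ≤ y ^ 2)
    (h2 : y ^ 2 ≤ 4 * x) (e : ℝ) : y ^ e ≤ 2 ^ |e| * x ^ (e / 2) := by
  have hy2 : y ^ e = (y ^ 2) ^ (e / 2) := by
    rw [← Real.rpow_natCast, ← Real.rpow_mul hy.le]
    congr 1
    push_cast
    ring
  rw [hy2]
  have h2e : (1 : ℝ) ≤ 2 ^ |e| := Real.one_le_rpow (by norm_num) (abs_nonneg e)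
  rcases le_total 0 e with he | he
  · have h4 : (2 : ℝ) ^ |e| = 4 ^ (e / 2) := by
      rw [abs_of_nonneg he, show (4 : ℝ) = 2 ^ (2 : ℝ) by norm_num, ← Real.rpow_mul (by norm_num)]
      congr 1
      ring
    rw [h4, ← Real.mul_rpow (by norm_num) hx.le]
    exact Real.rpow_le_rpow (by positivity) h2 (by linarith)
  · refine (Real.rpow_le_rpow_of_nonpos hx h1 (by linarith)).trans ?_
    exact le_mul_of_one_le_left (by positivity) h2e

theorem one_le_log_natCast_add_two {n : ℕ} (hn : 1 ≤ n) : 1 ≤ Real.log ((n : ℝ) + 2) := by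
  rw [Real.le_log_iff_exp_le (by positivity)]
  have : (1 : ℝ) ≤ n := by exact_mod_cast hn
  linarith [Real.exp_one_lt_d9]

theorem norm_pow_le_of_large [CompleteSpace X] {θ₀ θ₁ U L : ℝ} (hp : 1 ≤ p) (hE1 : 1 ≤ E)
    (hE : IntervalProjectionBound X p E) (hθ₀ : 0 ≤ θ₀) (hθ₁ : 0 ≤ θ₁) (hU1 : 1 ≤ U) (hL1 : 1 ≤ L)
    (hU : UpperBlockBound X p θ₀ U) (hL : LowerBlockBound X p θ₁ L) (K : ℝ) :
    ∃ C β : ℝ, 0 ≤ C ∧ 0 < β ∧ ∀ T : X →L[ℂ] X, IsStronglyKreissBounded T K →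
      ∀ n : ℕ, 4608 ≤ n →
        ‖T ^ n‖ ≤ C * (n : ℝ) ^ ((θ₀ + θ₁ - 1) / 2) * Real.log ((n : ℝ) + 2) ^ β := by
  have hE0 : 0 ≤ E := by linarith
  obtain ⟨W, hW⟩ : ∃ W, W = 10 * E * (|K| + 2) := ⟨_, rfl⟩
  have hW1 : 1 ≤ W := by nlinarith [abs_nonneg K]
  obtain ⟨D, hD⟩ : ∃ D, D = ∑ j ∈ Finset.range 128, 2 ^ (j + 1) * (E * (|K| + 2)) := ⟨_, rfl⟩
  have hD0 : 0 ≤ D := by rw [hD]; positivity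
  have h4₀ : 1 ≤ (4 : ℝ) ^ θ₀ := Real.one_le_rpow (by norm_num) hθ₀
  have h4₁ : 1 ≤ (4 : ℝ) ^ θ₁ := Real.one_le_rpow (by norm_num) hθ₁
  obtain ⟨A₀, hA₀⟩ : ∃ A, A = U * 4 ^ θ₀ * W := ⟨_, rfl⟩
  obtain ⟨A₁, hA₁⟩ : ∃ A, A = L * E * 4 ^ θ₁ * W := ⟨_, rfl⟩
  have hA₀1 : 1 ≤ A₀ := by
    rw [hA₀]; exact one_le_mul_of_one_le_of_one_le (one_le_mul_of_one_le_of_one_le hU1 h4₀) hW1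
  have hA₁1 : 1 ≤ A₁ := by
    rw [hA₁]
    exact one_le_mul_of_one_le_of_one_le
      (one_le_mul_of_one_le_of_one_le (one_le_mul_of_one_le_of_one_le hL1 hE1) h4₁) hW1
  -- The product of the two per-step losses. The factor `2` forces `Q > 1`, so that `β = logb 2 Q`
  -- is positive.
  obtain ⟨Q, hQ⟩ : ∃ Q, Q = 2 * ((E * A₀ * 4 ^ θ₀) * (E * A₁ * 4 ^ θ₁)) := ⟨_, rfl⟩
  have hQ1 : 1 ≤ (E * A₀ * 4 ^ θ₀) * (E * A₁ * 4 ^ θ₁) :=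
    one_le_mul_of_one_le_of_one_le
      (one_le_mul_of_one_le_of_one_le (one_le_mul_of_one_le_of_one_le hE1 hA₀1) h4₀)
      (one_le_mul_of_one_le_of_one_le (one_le_mul_of_one_le_of_one_le hE1 hA₁1) h4₁)
  obtain ⟨β, hβ⟩ : ∃ β, β = Real.logb 2 Q := ⟨_, rfl⟩
  have hβ0 : 0 < β := by rw [hβ]; exact Real.logb_pos (by norm_num) (by linarith)
  refine ⟨(E * (E * D)) ^ 2 * W * 2 ^ |θ₀ + θ₁ - 1| * 8 ^ β, β, by positivity, hβ0,
    fun T hT n hn => ?_⟩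
  have hpow : ∑ j ∈ Finset.range 128, ‖T ^ j‖ ≤ D := by
    rw [hD]
    exact Finset.sum_le_sum fun j _ => norm_pow_le_of_isStronglyKreissBounded hp hE hE0 hT j
  have hDE : D ≤ E * D := le_mul_of_one_le_left hD0 hE1
  obtain ⟨μ, hμ0, hμ1, hμ2, hμn⟩ : ∃ μ : ℕ, 0 < μ ∧ n ≤ μ ^ 2 ∧ μ ^ 2 ≤ 2 * n ∧ μ ≤ n := by
    refine ⟨Nat.sqrt (n - 1) + 1, by omega, ?_, ?_, ?_⟩
    · have := Nat.lt_succ_sqrt' (n - 1)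
      rw [Nat.succ_eq_add_one] at this
      omega
    · have := Nat.sqrt_le' (n - 1)
      have h2 : Nat.sqrt (n - 1) ^ 2 + 1 ≤ n := by omega
      nlinarith [sq_nonneg ((Nat.sqrt (n - 1) : ℤ) - 1)]
    · have := Nat.sqrt_le_self (n - 1)
      omega
  -- This is where `4608 = 2 * 48 ^ 2` comes from: `n < 48 μ` and `μ ^ 2 ≤ 2 n` would give `n <
  -- 4608`.
  have h48 : 48 * μ ≤ n := by
    by_contra hlt
    nlinarith
  obtain ⟨k, hk1, hk2⟩ := exists_le_two_pow_two_pow n (by omega)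
  have hμR : (0 : ℝ) < μ := by exact_mod_cast hμ0
  have h₀ := square_root_recursion (P := OrbitBound p T) (C := E * D) hθ₀ hA₀1 hE1 (by positivity)
    (fun h hS => h.mono_right hS) (fun _ hLL h => h.mono_left hE hE0 hLL)
    ((orbitBound_of_norm_pow hp 128).mono_right (hpow.trans hDE))
    (fun {ν S} hν _ h => (h.step hp hE hE0 hU hT hν).mono_right (le_of_eq (by
      rw [hA₀, Nat.cast_mul, Real.mul_rpow (by positivity) (by positivity), hW]
      push_cast
      ring))) k μ hμ0 (hμn.trans hk1)
  have h₁ := square_root_recursion (P := PairingBound p T) (C := E * D) hθ₁ hA₁1 hE1 (by positivity)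
    (fun h hS => h.mono_right hS) (fun hS hLL h => h.mono_left hE hS hLL)
    ((pairingBound_of_norm_pow hp hE 128).mono_right (mul_le_mul_of_nonneg_left hpow hE0))
    (fun {ν S} hν hS h => (h.step hp hE hE1 hL (by linarith) hT hν hS).mono_right (le_of_eq (by
      rw [hA₁, Nat.cast_mul, Real.mul_rpow (by positivity) (by positivity), hW]
      push_cast
      ring))) k μ hμ0 (hμn.trans hk1)
  have hmain := mul_norm_pow_le hp hE hE0 hT hμ0 h48 hμ1 (by positivity) (by positivity) h₀ h₁
  rw [← hW] at hmain
  have hmu : ‖T ^ n‖ ≤ (E * (E * D)) ^ 2 * W * Q ^ k * (μ : ℝ) ^ (θ₀ + θ₁ - 1) := by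
    have h1 : (μ : ℝ) * ‖T ^ n‖ ≤ 32 * (μ : ℝ) * ‖T ^ n‖ := by
      have : 0 ≤ (μ : ℝ) * ‖T ^ n‖ := by positivity
      linarith
    have h2 : ((E * A₀ * 4 ^ θ₀) * (E * A₁ * 4 ^ θ₁)) ^ k ≤ Q ^ k :=
      pow_le_pow_left₀ (by positivity) (by linarith) k
    rw [Real.rpow_sub hμR, Real.rpow_one, mul_div_assoc', le_div_iff₀ hμR, mul_comm,
      Real.rpow_add hμR]
    refine (h1.trans hmain).trans ?_
    calc _ = (E * (E * D)) ^ 2 * W * ((E * A₀ * 4 ^ θ₀) * (E * A₁ * 4 ^ θ₁)) ^ k *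
          ((μ : ℝ) ^ θ₀ * (μ : ℝ) ^ θ₁) := by rw [mul_pow (E * A₀ * 4 ^ θ₀)]; ring
      _ ≤ _ := by gcongr
  have hnR : (0 : ℝ) < n := by exact_mod_cast (by omega : 0 < n)
  have hmue := rpow_le_of_sq_comparable hnR hμR (by exact_mod_cast hμ1)
    (by exact_mod_cast (by omega : μ ^ 2 ≤ 4 * n)) (θ₀ + θ₁ - 1)
  have hlog := one_le_log_natCast_add_two (n := n) (by omega)
  have hQk : Q ^ k ≤ 8 ^ β * Real.log ((n : ℝ) + 2) ^ β := by
    have hQβ : Q = 2 ^ β := by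
      rw [hβ, Real.rpow_logb (by norm_num) (by norm_num) (by linarith)]
    rw [hQβ, ← Real.rpow_natCast, ← Real.rpow_mul (by norm_num), mul_comm β,
      Real.rpow_mul (by norm_num), Real.rpow_natCast, ← Real.mul_rpow (by norm_num) (by linarith)]
    exact Real.rpow_le_rpow (by positivity) hk2 hβ0.le
  calc ‖T ^ n‖ ≤ (E * (E * D)) ^ 2 * W * Q ^ k * (μ : ℝ) ^ (θ₀ + θ₁ - 1) := hmu
    _ ≤ (E * (E * D)) ^ 2 * W * (8 ^ β * Real.log ((n : ℝ) + 2) ^ β) *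
        (2 ^ |θ₀ + θ₁ - 1| * (n : ℝ) ^ ((θ₀ + θ₁ - 1) / 2)) := by gcongr
    _ = _ := by ring

theorem norm_pow_le_of_blockBounds [CompleteSpace X] {θ₀ θ₁ U L : ℝ} (hp : 1 ≤ p) (hE1 : 1 ≤ E)
    (hE : IntervalProjectionBound X p E) (hθ₀ : 0 ≤ θ₀) (hθ₁ : 0 ≤ θ₁) (hU1 : 1 ≤ U) (hL1 : 1 ≤ L)
    (hU : UpperBlockBound X p θ₀ U) (hL : LowerBlockBound X p θ₁ L) (K : ℝ) :
    ∃ C β : ℝ, 0 < C ∧ 0 < β ∧ ∀ T : X →L[ℂ] X, IsStronglyKreissBounded T K →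
      ∀ n : ℕ, 1 ≤ n →
        ‖T ^ n‖ ≤ C * (n : ℝ) ^ ((θ₀ + θ₁ - 1) / 2) * Real.log ((n : ℝ) + 2) ^ β := by
  obtain ⟨C, β, hC, hβ, h⟩ := norm_pow_le_of_large hp hE1 hE hθ₀ hθ₁ hU1 hL1 hU hL K
  generalize 4608 = N at h
  generalize (θ₀ + θ₁ - 1) / 2 = e at h ⊢
  refine ⟨C + 2 ^ (N + 1) * (E * (|K| + 2)) * ((N : ℝ) + 1) ^ |e|, β, by positivity, hβ,
    fun T hT n hn => ?_⟩
  have hlog := one_le_log_natCast_add_two hn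
  have hlogβ : 1 ≤ Real.log ((n : ℝ) + 2) ^ β := Real.one_le_rpow hlog hβ.le
  have hn1 : (1 : ℝ) ≤ n := by exact_mod_cast hn
  rcases le_total N n with hNn | hNn
  · refine (h T hT n hNn).trans ?_
    gcongr
    exact le_add_of_nonneg_right (by positivity)
  -- For small `n` the crude exponential bound is a constant; this factor compensates for `n ^ e`
  -- when `e` is negative.
  · have h1 : 1 ≤ ((N : ℝ) + 1) ^ |e| * (n : ℝ) ^ e := by
      have h2 : (n : ℝ) ≤ (N : ℝ) + 1 := by
        have : (n : ℝ) ≤ N := by exact_mod_cast hNn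
        linarith
      have h3 : (n : ℝ) ^ (-|e|) ≤ (n : ℝ) ^ e :=
        Real.rpow_le_rpow_of_exponent_le hn1 (neg_abs_le e)
      have h4 : (n : ℝ) ^ |e| ≤ ((N : ℝ) + 1) ^ |e| :=
        Real.rpow_le_rpow (by positivity) h2 (abs_nonneg e)
      calc (1 : ℝ) = (n : ℝ) ^ |e| * (n : ℝ) ^ (-|e|) := by
            rw [← Real.rpow_add (by linarith), add_neg_cancel, Real.rpow_zero]
        _ ≤ _ := by gcongr
    calc ‖T ^ n‖ ≤ 2 ^ (n + 1) * (E * (|K| + 2)) :=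
          norm_pow_le_of_isStronglyKreissBounded hp hE (by linarith) hT n
      _ ≤ 2 ^ (N + 1) * (E * (|K| + 2)) := by gcongr; norm_num
      _ ≤ 2 ^ (N + 1) * (E * (|K| + 2)) * (((N : ℝ) + 1) ^ |e| * (n : ℝ) ^ e) *
          Real.log ((n : ℝ) + 2) ^ β := by
        rw [mul_assoc]
        exact le_mul_of_one_le_right (by positivity) (one_le_mul_of_one_le_of_one_le h1 hlogβ)
      _ ≤ _ := by
        rw [add_mul, add_mul, mul_assoc _ (((N : ℝ) + 1) ^ |e|)]
        exact le_add_of_nonneg_left (by positivity)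

end Growth

/-! ### Block bounds from the decomposition hypotheses -/

section Decompositions

variable {X : Type*} [NormedAddCommGroup X] [NormedSpace ℂ X] {p : ℝ}

theorem intervalProjectionBound_of_halfLine {H : ℝ} (hH : 0 ≤ H)
    (h1 : ∀ (n : ℤ) (a : ℤ →₀ X), coeffNorm p (freqCut (Set.Ici n) a) ≤ H * coeffNorm p a)
    (h2 : ∀ (n : ℤ) (a : ℤ →₀ X), coeffNorm p (freqCut (Set.Iio n) a) ≤ H * coeffNorm p a) :
    IntervalProjectionBound X p (H * H) := fun u v a => by
  rw [← Set.Ici_inter_Iio, ← freqCut_freqCut, mul_assoc]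
  exact (h1 _ _).trans (mul_le_mul_of_nonneg_left (h2 _ _) hH)

theorem upperBlockBound_of_sum_rpow {q γ U : ℝ} (hq : 0 < q) (hU : 0 ≤ U)
    (h : ∀ s m : ℕ, 0 < s → 0 < m → ∀ a : ℤ →₀ X, (∀ n ∉ Set.Ico (0 : ℤ) (s * m : ℕ), a n = 0) →
      coeffNorm p a ≤ U * (m : ℝ) ^ γ *
        (∑ i ∈ Finset.range m, coeffNorm p (freqCut (freqBlock s i) a) ^ q) ^ (1 / q)) :
    UpperBlockBound X p (γ + 1 / q) U := by
  intro s m hs hm a ha B hB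
  have hm' : (0 : ℝ) < m := by exact_mod_cast hm
  have hB0 : 0 ≤ B := (coeffNorm_nonneg _).trans (hB 0 hm)
  refine (h s m hs hm a ha).trans ?_
  rw [Real.rpow_add hm', mul_assoc U, mul_assoc U, mul_assoc (_ ^ γ)]
  refine mul_le_mul_of_nonneg_left (mul_le_mul_of_nonneg_left ?_ (by positivity)) hU
  have h1 : ∑ i ∈ Finset.range m, coeffNorm p (freqCut (freqBlock s i) a) ^ q ≤ m * B ^ q := by
    refine (Finset.sum_le_card_nsmul _ _ (B ^ q) fun i hi => ?_).trans_eq (by simp)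
    exact Real.rpow_le_rpow (coeffNorm_nonneg _) (hB i (Finset.mem_range.1 hi)) hq.le
  refine (Real.rpow_le_rpow (Finset.sum_nonneg fun i _ =>
    Real.rpow_nonneg (coeffNorm_nonneg _) _) h1 (by positivity)).trans_eq ?_
  rw [Real.mul_rpow hm'.le (by positivity), ← Real.rpow_mul hB0, mul_one_div_cancel hq.ne',
    Real.rpow_one]

/-- Hölder's inequality between `ℓ^1` and `ℓ^q` over `m` terms costs `m ^ (1 - 1 / q)`. -/
theorem lowerBlockBound_of_sum_rpow {q γ L : ℝ} (hq : 1 < q)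
    (h : ∀ s m : ℕ, 0 < s → 0 < m → ∀ a : ℤ →₀ X, (∀ n ∉ Set.Ico (0 : ℤ) (s * m : ℕ), a n = 0) →
      (∑ i ∈ Finset.range m, coeffNorm p (freqCut (freqBlock s i) a) ^ q) ^ (1 / q) ≤
        L * (m : ℝ) ^ γ * coeffNorm p a) :
    LowerBlockBound X p (1 - 1 / q + γ) L := by
  intro s m hs hm a ha
  have hm' : (0 : ℝ) < m := by exact_mod_cast hm
  have hq0 : 0 < q := by linarith
  have h1 := Real.rpow_sum_le_const_mul_sum_rpow (Finset.range m)
    (fun i => coeffNorm p (freqCut (freqBlock s i) a)) hq.le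
  simp only [abs_of_nonneg (coeffNorm_nonneg _), Finset.card_range] at h1
  have h0 : 0 ≤ ∑ i ∈ Finset.range m, coeffNorm p (freqCut (freqBlock s i) a) :=
    Finset.sum_nonneg fun i _ => coeffNorm_nonneg _
  have h2 := Real.rpow_le_rpow (by positivity) h1 (by positivity : 0 ≤ 1 / q)
  rw [← Real.rpow_mul h0, mul_one_div_cancel hq0.ne', Real.rpow_one,
    Real.mul_rpow (by positivity) (Finset.sum_nonneg fun i _ =>
    Real.rpow_nonneg (coeffNorm_nonneg _) _), ← Real.rpow_mul hm'.le,
    show (q - 1) * (1 / q) = 1 - 1 / q by field_simp] at h2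
  refine h2.trans ((mul_le_mul_of_nonneg_left (h s m hs hm a ha) (by positivity)).trans_eq ?_)
  rw [Real.rpow_add hm']
  ring

theorem le_rpow_sum_rpow {ι : Type*} {s : Finset ι} {f : ι → ℝ} (hf : ∀ i, 0 ≤ f i) {q : ℝ}
    (hq : 0 < q) {i : ι} (hi : i ∈ s) : f i ≤ (∑ j ∈ s, f j ^ q) ^ (1 / q) := by
  have h1 : f i ^ q ≤ ∑ j ∈ s, f j ^ q :=
    Finset.single_le_sum (f := fun j => f j ^ q) (fun j _ => Real.rpow_nonneg (hf j) q) hi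
  have h2 := Real.rpow_le_rpow (Real.rpow_nonneg (hf i) q) h1 (by positivity : 0 ≤ 1 / q)
  rwa [← Real.rpow_mul (hf i), mul_one_div_cancel hq.ne', Real.rpow_one] at h2

theorem Iio_ne_Ici (n : ℤ) : Set.Iio n ≠ Set.Ici n := fun h => by
  have : n ∈ Set.Iio n := h ▸ Set.mem_Ici.2 le_rfl
  exact lt_irrefl n this

/-- The interval `[s i, s (i + 1))` of `ℤ`. -/
def intBlock (s : ℕ) (i : ℤ) : Set ℤ := Set.Ico (s * i) (s * i + s)

theorem mem_intBlock_iff {s : ℕ} (hs : 0 < s) {i n : ℤ} : n ∈ intBlock s i ↔ n / s = i := by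
  have hs' : (0 : ℤ) < s := by exact_mod_cast hs
  rw [intBlock, Set.mem_Ico, Int.ediv_eq_iff_of_pos hs']
  constructor <;> rintro ⟨h1, h2⟩ <;> constructor <;> linarith

theorem freqBlock_eq_intBlock (s i : ℕ) : freqBlock s i = intBlock s i := by
  rw [freqBlock, intBlock, Nat.cast_mul]

theorem intBlock_nonempty {s : ℕ} (hs : 0 < s) (i : ℤ) : (intBlock s i).Nonempty :=
  ⟨s * i, by rw [mem_intBlock_iff hs, Int.mul_ediv_cancel_left _ (by omega)]⟩

theorem intBlock_injective {s : ℕ} (hs : 0 < s) : Function.Injective (intBlock s) := by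
  intro i j hij
  obtain ⟨n, hn⟩ := intBlock_nonempty hs i
  have hn' : n ∈ intBlock s j := hij ▸ hn
  rw [mem_intBlock_iff hs] at hn hn'
  rw [← hn, hn']

theorem isIntervalPartition_range_intBlock {s : ℕ} (hs : 0 < s) :
    IsIntervalPartition (Set.range (intBlock s)) := by
  refine ⟨⟨?_, fun n => ⟨intBlock s (n / s), ⟨⟨_, rfl⟩, (mem_intBlock_iff hs).2 rfl⟩, ?_⟩⟩, ?_⟩
  · rintro ⟨i, hi⟩
    exact (intBlock_nonempty hs i).ne_empty hi
  · rintro _ ⟨⟨i, rfl⟩, hi⟩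
    rw [(mem_intBlock_iff hs).1 hi]
  · rintro _ ⟨i, rfl⟩
    exact Set.ordConnected_Ico

theorem isIntervalPartition_halfLines (n : ℤ) :
    IsIntervalPartition {Set.Iio n, Set.Ici n} := by
  refine ⟨⟨?_, fun k => ?_⟩, ?_⟩
  · rintro (h | h)
    · exact (Set.nonempty_Iio (a := n)).ne_empty h.symm
    · exact (Set.nonempty_Ici (a := n)).ne_empty h.symm
  · rcases lt_or_ge k n with hk | hk
    · refine ⟨Set.Iio n, ⟨Or.inl rfl, hk⟩, ?_⟩
      rintro _ ⟨rfl | rfl, h⟩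
      · rfl
      · exact absurd hk (not_lt.2 h)
    · refine ⟨Set.Ici n, ⟨Or.inr rfl, hk⟩, ?_⟩
      rintro _ ⟨rfl | rfl, h⟩
      · exact absurd h (not_lt.2 hk)
      · rfl
  · rintro _ (rfl | rfl)
    · exact Set.ordConnected_Iio
    · exact Set.ordConnected_Ici

theorem freqCut_intBlock_eq_zero {X : Type*} [NormedAddCommGroup X] {s m : ℕ} (hs : 0 < s) {a : ℤ →₀ X}
    (ha : ∀ n ∉ Set.Ico (0 : ℤ) (s * m : ℕ), a n = 0) {i : ℤ} (hi : i ∉ Set.Ico (0 : ℤ) m) :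
    freqCut (intBlock s i) a = 0 := by
  ext n
  by_cases hn : n ∈ intBlock s i
  · rw [freqCut_apply_of_mem hn, Finsupp.zero_apply]
    refine ha n fun h => hi ?_
    have hs' : (0 : ℤ) < s := by exact_mod_cast hs
    rw [mem_intBlock_iff hs] at hn
    rw [← hn]
    refine ⟨Int.ediv_nonneg h.1 hs'.le, Int.ediv_lt_of_lt_mul hs' ?_⟩
    have := h.2
    push_cast at this
    linarith
  · rw [freqCut_apply_of_notMem hn, Finsupp.zero_apply]

/-- Part (b) concerns partitions of all of `ℤ`, so the blocks are continued in both directions; only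
the first `m` nonnegative ones meet the frequencies of `a`. -/
theorem tsum_intBlock_eq [CompleteSpace X] {q : ℝ} (hq : 0 < q) {s m : ℕ} (hs : 0 < s)
    {a : ℤ →₀ X} (ha : ∀ n ∉ Set.Ico (0 : ℤ) (s * m : ℕ), a n = 0) :
    ∑' I : Set.range (intBlock s), torusNorm p (fourierCut (I : Set ℤ) (trigPoly a)) ^ q =
      ∑ i ∈ Finset.range m, coeffNorm p (freqCut (freqBlock s i) a) ^ q := by
  rw [tsum_range (fun I => torusNorm p (fourierCut I (trigPoly a)) ^ q) (intBlock_injective hs),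
    tsum_eq_sum (s := (Finset.range m).map Nat.castEmbedding), Finset.sum_map]
  · refine Finset.sum_congr rfl fun i _ => ?_
    rw [fourierCut_trigPoly, freqBlock_eq_intBlock]
    rfl
  · intro i hi
    have hi' : i ∉ Set.Ico (0 : ℤ) m := fun h => hi (by
      refine Finset.mem_map.2 ⟨i.toNat, Finset.mem_range.2 ?_, Int.toNat_of_nonneg h.1⟩
      have := h.1
      have := h.2
      omega)
    have h0 := freqCut_intBlock_eq_zero hs ha hi'
    rw [fourierCut_trigPoly, h0]
    change coeffNorm p (0 : ℤ →₀ X) ^ q = 0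
    rw [coeffNorm_zero, Real.zero_rpow hq.ne']

theorem isDisjointIntervalFamily_image [DecidableEq (Set ℤ)] {s : ℕ} (hs : 0 < s) (m : ℕ) :
    IsDisjointIntervalFamily (((Finset.range m).image (freqBlock s) : Finset (Set ℤ)) :
      Set (Set ℤ)) := by
  have hP := isIntervalPartition_range_intBlock hs
  have hsub : (((Finset.range m).image (freqBlock s) : Finset (Set ℤ)) : Set (Set ℤ)) ⊆
      Set.range (intBlock s) := by
    intro I hI
    obtain ⟨i, _, rfl⟩ := Finset.mem_image.1 (Finset.mem_coe.1 hI)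
    exact ⟨i, (freqBlock_eq_intBlock s i).symm⟩
  exact ⟨fun I hI => hP.2 I (hsub hI), hP.1.pairwiseDisjoint.subset hsub⟩

theorem support_subset_iUnion_image [DecidableEq (Set ℤ)] [CompleteSpace X] {s m : ℕ} (hs : 0 < s)
    {a : ℤ →₀ X} (ha : ∀ n ∉ Set.Ico (0 : ℤ) (s * m : ℕ), a n = 0) :
    Function.support (fourierCoeff (trigPoly a)) ⊆
      ⋃ I ∈ (Finset.range m).image (freqBlock s), I := by
  intro n hn
  rw [Function.mem_support, fourierCoeff_trigPoly] at hn
  have h := not_imp_comm.1 (ha n) hn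
  have hs' : (0 : ℤ) < s := by exact_mod_cast hs
  have h0 : 0 ≤ n / s := Int.ediv_nonneg h.1 hs'.le
  have hm : n / s < m := by
    refine Int.ediv_lt_of_lt_mul hs' ?_
    have := h.2
    push_cast at this
    linarith
  refine Set.mem_biUnion (x := freqBlock s (n / s).toNat)
    (Finset.mem_image_of_mem _ (Finset.mem_range.2 (by omega))) ?_
  rw [freqBlock_eq_intBlock, mem_intBlock_iff hs, Int.toNat_of_nonneg h0]

theorem upperBlockBound_of_growth [CompleteSpace X] {q γ : ℝ} (hq : 0 < q)
    (h : HasUpperDecompositionsWithGrowth X p q γ) :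
    ∃ U, 1 ≤ U ∧ UpperBlockBound X p (γ + 1 / q) U := by
  classical
  obtain ⟨U, hU0, hU⟩ := h
  refine ⟨max U 1, le_max_right _ _, upperBlockBound_of_sum_rpow hq (by positivity) ?_⟩
  intro s m hs hm a ha
  have hinj : Function.Injective (freqBlock s) := fun i j hij => by
    rw [freqBlock_eq_intBlock, freqBlock_eq_intBlock] at hij
    exact_mod_cast intBlock_injective hs hij
  have h1 := hU ((Finset.range m).image (freqBlock s)) (isDisjointIntervalFamily_image hs m)
    (trigPoly a) (isTrigPoly_trigPoly a) (support_subset_iUnion_image hs ha)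
  rw [Finset.card_image_of_injective _ hinj, Finset.card_range,
    Finset.sum_image fun _ _ _ _ h => hinj h] at h1
  simp only [fourierCut_trigPoly] at h1
  refine h1.trans (mul_le_mul_of_nonneg_right (mul_le_mul_of_nonneg_right (le_max_left _ _)
    (by positivity)) ?_)
  exact Real.rpow_nonneg (Finset.sum_nonneg fun i _ => Real.rpow_nonneg (coeffNorm_nonneg _) _) _

theorem lowerBlockBound_of_growth [CompleteSpace X] {q γ : ℝ} (hq : 1 < q)
    (h : HasLowerDecompositionsWithGrowth X p q γ) :
    ∃ L, 1 ≤ L ∧ LowerBlockBound X p (1 - 1 / q + γ) L := by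
  classical
  obtain ⟨L, hL0, hL⟩ := h
  refine ⟨max L 1, le_max_right _ _, lowerBlockBound_of_sum_rpow hq ?_⟩
  intro s m hs hm a ha
  have hinj : Function.Injective (freqBlock s) := fun i j hij => by
    rw [freqBlock_eq_intBlock, freqBlock_eq_intBlock] at hij
    exact_mod_cast intBlock_injective hs hij
  have h1 := hL ((Finset.range m).image (freqBlock s)) (isDisjointIntervalFamily_image hs m)
    (trigPoly a) (isTrigPoly_trigPoly a) (support_subset_iUnion_image hs ha)
  rw [Finset.card_image_of_injective _ hinj, Finset.card_range,
    Finset.sum_image fun _ _ _ _ h => hinj h] at h1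
  simp only [fourierCut_trigPoly] at h1
  exact h1.trans (mul_le_mul_of_nonneg_right (mul_le_mul_of_nonneg_right (le_max_left _ _)
    (by positivity)) (coeffNorm_nonneg _))

/-- Apply the lower estimate to the two half-lines at `n` and keep one term; a bounded interval is
an intersection of two half-lines. -/
theorem intervalProjectionBound_of_growth [CompleteSpace X] {q γ : ℝ} (hq : 0 < q)
    (h : HasLowerDecompositionsWithGrowth X p q γ) :
    ∃ E, 1 ≤ E ∧ IntervalProjectionBound X p E := by
  classical
  obtain ⟨L, hL0, hL⟩ := h
  have key : ∀ (n : ℤ) (a : ℤ →₀ X), ∀ I ∈ ({Set.Iio n, Set.Ici n} : Finset (Set ℤ)),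
      coeffNorm p (freqCut I a) ≤ L * 2 ^ γ * coeffNorm p a := by
    intro n a I hI
    have h1 := hL {Set.Iio n, Set.Ici n} ?_ (trigPoly a) (isTrigPoly_trigPoly a) ?_
    · rw [Finset.card_pair (Iio_ne_Ici n)] at h1
      simp only [fourierCut_trigPoly] at h1
      exact (le_rpow_sum_rpow (f := fun I => coeffNorm p (freqCut I a))
        (fun I => coeffNorm_nonneg _) hq hI).trans h1
    · rw [Finset.coe_pair]
      exact ⟨(isIntervalPartition_halfLines n).2,
        (isIntervalPartition_halfLines n).1.pairwiseDisjoint⟩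
    · intro k _
      rcases lt_or_ge k n with hk | hk
      · exact Set.mem_biUnion (by simp : Set.Iio n ∈ _) hk
      · exact Set.mem_biUnion (by simp : Set.Ici n ∈ _) hk
  have hH : 0 ≤ L * 2 ^ γ := by positivity
  exact ⟨_, le_max_right _ 1, (intervalProjectionBound_of_halfLine hH
    (fun n a => key n a _ (by simp)) (fun n a => key n a _ (by simp))).mono (le_max_left _ _)⟩

theorem upperBlockBound_of_decompositions [CompleteSpace X] {q : ℝ} (hq : 0 < q)
    (h : HasUpperDecompositions X p q) :
    ∃ U, 1 ≤ U ∧ UpperBlockBound X p (0 + 1 / q) U := by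
  obtain ⟨U, hU0, hU⟩ := h
  refine ⟨max U 1, le_max_right _ _, upperBlockBound_of_sum_rpow hq (by positivity) ?_⟩
  intro s m hs hm a ha
  have h1 := hU _ (isIntervalPartition_range_intBlock hs) _ (isTrigPoly_trigPoly a)
  rw [tsum_intBlock_eq hq hs ha] at h1
  rw [Real.rpow_zero, mul_one]
  refine h1.trans (mul_le_mul_of_nonneg_right (le_max_left _ _) ?_)
  exact Real.rpow_nonneg (Finset.sum_nonneg fun i _ => Real.rpow_nonneg (coeffNorm_nonneg _) _) _

theorem lowerBlockBound_of_decompositions [CompleteSpace X] {q : ℝ} (hq : 1 < q)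
    (h : HasLowerDecompositions X p q) :
    ∃ L, 1 ≤ L ∧ LowerBlockBound X p (1 - 1 / q + 0) L := by
  obtain ⟨L, hL0, hL⟩ := h
  refine ⟨max L 1, le_max_right _ _, lowerBlockBound_of_sum_rpow hq ?_⟩
  intro s m hs hm a ha
  have h1 := hL _ (isIntervalPartition_range_intBlock hs) _ (isTrigPoly_trigPoly a)
  rw [tsum_intBlock_eq (by linarith) hs ha] at h1
  rw [Real.rpow_zero, mul_one]
  exact h1.trans (mul_le_mul_of_nonneg_right (le_max_left _ _) (coeffNorm_nonneg _))

theorem intervalProjectionBound_of_decompositions [CompleteSpace X] {q : ℝ} (hq : 0 < q)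
    (h : HasLowerDecompositions X p q) :
    ∃ E, 1 ≤ E ∧ IntervalProjectionBound X p E := by
  classical
  obtain ⟨L, hL0, hL⟩ := h
  have key : ∀ (n : ℤ) (a : ℤ →₀ X), ∀ I ∈ ({Set.Iio n, Set.Ici n} : Finset (Set ℤ)),
      coeffNorm p (freqCut I a) ≤ L * coeffNorm p a := by
    intro n a I hI
    have h1 := hL (({Set.Iio n, Set.Ici n} : Finset (Set ℤ)) : Set (Set ℤ))
      (by rw [Finset.coe_pair]; exact isIntervalPartition_halfLines n)
      (trigPoly a) (isTrigPoly_trigPoly a)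
    rw [Finset.tsum_subtype' _ fun I => torusNorm p (fourierCut I (trigPoly a)) ^ q] at h1
    simp only [fourierCut_trigPoly] at h1
    exact (le_rpow_sum_rpow (f := fun I => coeffNorm p (freqCut I a))
      (fun I => coeffNorm_nonneg _) hq hI).trans h1
  exact ⟨_, le_max_right _ 1, (intervalProjectionBound_of_halfLine hL0.le
    (fun n a => key n a _ (by simp)) (fun n a => key n a _ (by simp))).mono (le_max_left _ _)⟩

end Decompositions

/-! ### The main theorem -/

theorem theorem3p1 {X : Type*} [NormedAddCommGroup X] [NormedSpace ℂ X] [CompleteSpace X]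
    (p q₀ q₁ : ℝ) (hp : 1 < p) (hq₀ : 1 < q₀) (hq₁ : 1 < q₁) :
    (∀ γ₀ γ₁ : ℝ, 0 ≤ γ₀ → γ₀ < 1 - 1 / q₀ → 0 ≤ γ₁ → γ₁ < 1 / q₁ →
      HasUpperDecompositionsWithGrowth X p q₀ γ₀ →
      HasLowerDecompositionsWithGrowth X p q₁ γ₁ →
      ∀ K : ℝ, ∃ C β : ℝ, 0 < C ∧ 0 < β ∧
        ∀ T : X →L[ℂ] X, IsStronglyKreissBounded T K → ∀ n : ℕ, 1 ≤ n →
          ‖T ^ n‖ ≤ C * (n : ℝ) ^ ((1 / q₀ - 1 / q₁ + γ₀ + γ₁) / 2) *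
            Real.log ((n : ℝ) + 2) ^ β) ∧
    (HasUpperDecompositions X p q₀ → HasLowerDecompositions X p q₁ →
      ∀ K : ℝ, ∃ C β : ℝ, 0 < C ∧ 0 < β ∧
        ∀ T : X →L[ℂ] X, IsStronglyKreissBounded T K → ∀ n : ℕ, 1 ≤ n →
          ‖T ^ n‖ ≤ C * (n : ℝ) ^ ((1 / q₀ - 1 / q₁) / 2) *
            Real.log ((n : ℝ) + 2) ^ β) := by
  constructor
  · intro γ₀ γ₁ hγ₀ _ hγ₁ _ hU hL K
    obtain ⟨U, hU1, hU⟩ := upperBlockBound_of_growth (by linarith) hU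
    obtain ⟨E, hE1, hE⟩ := intervalProjectionBound_of_growth (by linarith) hL
    obtain ⟨L, hL1, hL⟩ := lowerBlockBound_of_growth hq₁ hL
    have hq₁' : 1 / q₁ ≤ 1 := (div_le_one (by linarith)).2 hq₁.le
    have h := norm_pow_le_of_blockBounds hp.le hE1 hE (by positivity) (by linarith) hU1 hL1 hU hL K
    rwa [show γ₀ + 1 / q₀ + (1 - 1 / q₁ + γ₁) - 1 = 1 / q₀ - 1 / q₁ + γ₀ + γ₁ by ring] at h
  · intro hU hL K
    obtain ⟨U, hU1, hU⟩ := upperBlockBound_of_decompositions (by linarith) hU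
    obtain ⟨E, hE1, hE⟩ := intervalProjectionBound_of_decompositions (by linarith) hL
    obtain ⟨L, hL1, hL⟩ := lowerBlockBound_of_decompositions hq₁ hL
    have hq₁' : 1 / q₁ ≤ 1 := (div_le_one (by linarith)).2 hq₁.le
    have h := norm_pow_le_of_blockBounds hp.le hE1 hE (by positivity) (by linarith) hU1 hL1 hU hL K
    rwa [show 0 + 1 / q₀ + (1 - 1 / q₁ + 0) - 1 = 1 / q₀ - 1 / q₁ by ring] at h
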